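/- **Setting.** All uniformities are compatible with the given topologies and are ordered by inclusion. Let $X$ be an infinite linearly ordered set (chain) which is *ultrahomogeneous*: for all $n$ and $x_1<\dots<x_n$, $y_1<\dots<y_n$ in $X$ there is $g\in\mathrm{Aut}(X)$ with $g(x_k)=y_k$ for all $k$. Give $X$ the discrete topology and $G=\mathrm{Aut}(X)$ the permutation topology, with subbase $\{g: gx=y\}$, $x,y\in X$; let $\alpha:G\times X\to X$ be the natural action. *Gaps and $b_mX$.* A gap of $X$ is a partition $X=A\sqcup B$ with $A<B$, $A$ without greatest and $B$ without least element; it is proper if $A,B\neq\emptyset$. $X$ is *continuous* if it has no proper gaps. Let $b_mX=(X\times\{-1,0,1\})\cup\Gamma$, where $\Gamma$ is the set of all gaps, ordered lexicographically on $X\times\{-1,0,1\}$ with a gap $(A,B)$ placed above the points over $A$ and below the points over $B$ (and gaps ordered by inclusion of their lower classes), with the order topology; $\inf$ and $\sup$ are its least and greatest points, $X$ is identified with $X\times\{0\}$, and $G$ acts by $g(x,j)=(gx,j)$, $g(A,B)=(gA,gB)$. *Equiuniformities.* For a topological group $H$ acting on a space $Y$, a uniformity $\mathcal U$ on $Y$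 is an *equiuniformity* if each $h\in H$ acts uniformly continuously and for each uniform cover $u$ there are a neighbourhood $O$ of the unit and a uniform cover $v$ such that $\{OV: V\in v\}$ refines $u$. For $\mathcal U$ a totally bounded equiuniformity with completion $\tilde Y$ and extended action $\tilde\alpha$, $\mathfrak E_\alpha(\mathcal U)$ (resp. $\tilde{\mathfrak E}_\alpha(\mathcal U)$) is the uniformity on $H$ induced by the uniformity of pointwise convergence on $Y^Y$ (resp. $\tilde Y^{\tilde Y}$) via $h\mapsto \alpha(h,\cdot)$ (resp. $h\mapsto\tilde\alpha(h,\cdot)$). For the action of $H$ on itself by left multiplication we write $\tilde{\mathfrak E}_*$. *Uniformities on $G$.* $L\wedge R$ is the Roelcke uniformity, the greatest lower bound of the left and right uniformities. For an action of $G$ on a set $Y$, $R_{\Sigma_Y}$ is the uniformity with base of covers $\{Og\,\mathrm{St}_\sigma: g\in G\}$, $O$ a neighbourhood of the unit, $\sigma\subset Y$ finite, $\mathrm{St}_\sigma$ the pointwise stabilizer of $\sigma$. *Ellis compactifications.* A *proper enveloping Ellis semigroup compactification* of $G$ is a compact Hausdorff semigroup $S$ in which all maps $x\mapsto xy$ are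 continuous, with a homomorphism $s:G\to S$ that is a topological embedding with dense image, such that multiplication restricted to $s(G)\times S$ is continuous. $\mathbb E(G)$ is the set of totally bounded equiuniformities on $G$ (for left multiplication) whose completion carries such a structure (with $s$ the canonical map). **Theorem.** The maximal equiuniformity $\mathcal U_X$ on $X$ for $\alpha$ exists, and: (a) $\mathcal U_X$ is totally bounded; $b_mX$ is the smallest linearly ordered compactification of the discrete space $X$; and the completion of $(X,\mathcal U_X)$ is $b_mX$ ($G$-equivariantly homeomorphic over $X$). (b) $\mathfrak E_\alpha(\mathcal U_X)=L\wedge R=R_{\Sigma_X}\subset R_{\Sigma_{b_mX}}$, and $L\wedge R$ is a totally bounded equiuniformity, i.e. in particular $G$ is Roelcke precompact. (c) $L\wedge R\subset\tilde{\mathfrak E}_\alpha(\mathcal U_X)=R_{\Sigma_{b_mX}}=\tilde{\mathfrak E}_*(L\wedge R)\in\mathbb E(G)$, and $L\wedge R\notin\mathbb E(G)$ if $R_{\Sigma_X}\neq R_{\Sigma_{b_mX}}$. (d) The completion $bG$ of $(G,R_{\Sigma_{b_mX}})$ is (homeomorphic over $G$ to) the set of all maps $f:b_mX\to b_mX$,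 in the topology of pointwise convergence, such that (i) $x<y$ implies $f(x)\le f(y)$; (ii) $f(x)\notin X$ if $x\in b_mX\setminus X$; (iii) if $f(x)=f(y)$ and $x\ne y$, then $f(x)\in b_mX\setminus X$; (iv) for every $x\in X$, either $f((x,-1))=f((x,0))=f((x,1))\notin X$, or there is $y\in X$ with $f((x,j))=(y,j)$ for $j=-1,0,1$; (v) $f(\inf)=\inf$ and $f(\sup)=\sup$; and this set, with composition and $g\mapsto(p\mapsto gp)$, is a proper enveloping Ellis semigroup compactification of $G$. (e) The Roelcke compactification $b_rG$, i.e. the completion of $(G,L\wedge R)$, is (homeomorphic over $G$ to) the set of all monotone maps $f:X\to b_mX$, in the topology of pointwise convergence, such that (ii$'$) if $f(x)=f(y)$ and $x\neq y$, then $f(x)\in b_mX\setminus X$; here $g\in G$ corresponds to $x\mapsto (gx,0)$. If $X$ is continuous, then moreover (b$'$) $\tilde{\mathfrak E}_\alpha(\mathcal U_X)=\mathfrak E_\alpha(\mathcal U_X)=L\wedge R=R_{\Sigma_X}=R_{\Sigma_{b_mX}}$; (c$'$) $L\wedge R\in\mathbb E(G)$, i.e. $b_rG$ is a proper enveloping Ellis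 semigroup compactification of $G$, and $b_rG=bG$ as compactifications of $G$. -/

import Mathlib

open Topology Uniformity Filter

noncomputable section

namespace ChainEllis

universe u

/-! ### Uniform covers and completions for an explicitly given uniformity

In Mathlib the order on `UniformSpace Y` is: `U ≤ V` iff `U` is finer than `V`, i.e. iff every
entourage of `V` is an entourage of `U` (`V ⊆ U` as sets of entourages). -/

section Uniform

variable {Y : Type*}

/-- A family of sets `c` is a uniform cover for the uniformity `U`. -/
def IsUniformCover (U : UniformSpace Y) (c : Set (Set Y)) : Prop :=
  ∃ V ∈ 𝓤[U], ∀ x : Y, ∃ C ∈ c, {y | (x, y) ∈ V} ⊆ C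

/-- `U` is totally bounded (precompact). -/
def IsTotallyBounded (U : UniformSpace Y) : Prop :=
  @TotallyBounded Y U Set.univ

/-- The (Hausdorff) completion of `(Y, U)`. -/
def UCompl (U : UniformSpace Y) : Type _ := @UniformSpace.Completion Y U

instance (U : UniformSpace Y) : UniformSpace (UCompl U) :=
  @UniformSpace.Completion.uniformSpace Y U

/-- The canonical map of `Y` to its completion. -/
def UCompl.coe (U : UniformSpace Y) : Y → UCompl U :=
  fun y => @UniformSpace.Completion.coe' Y U y

/-- The continuous extension to the completion of a (uniformly continuous) self-map of `Y`. -/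
def UCompl.map (U : UniformSpace Y) (f : Y → Y) : UCompl U → UCompl U :=
  @UniformSpace.Completion.map Y U Y U f

end Uniform

/-! ### Equiuniformities -/

section Equi

variable (G : Type*) [Group G] [TopologicalSpace G]
variable {Y : Type*} [MulAction G Y]

/-- An equiuniformity on the topological space `Y` for the action of the topological group `G`:
a compatible uniformity which is saturated and bounded. -/
structure IsEquiuniformity [t : TopologicalSpace Y] (U : UniformSpace Y) : Prop where
  compatible : U.toTopologicalSpace = t
  saturated : ∀ g : G, @UniformContinuous Y Y U U (fun y => g • y)
  bounded : ∀ c : Set (Set Y), IsUniformCover U c →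
    ∃ O ∈ 𝓝 (1 : G), ∃ d : Set (Set Y), IsUniformCover U d ∧
      ∀ D ∈ d, ∃ C ∈ c, ∀ g ∈ O, ∀ y ∈ D, g • y ∈ C

/-- The maximal (finest) equiuniformity. -/
def IsMaximalEquiuniformity [TopologicalSpace Y] (U : UniformSpace Y) : Prop :=
  IsLeast {V : UniformSpace Y | IsEquiuniformity G V} U

/-- A totally bounded equiuniformity (an element of `𝔹𝕌(Y)`). -/
def IsTBEquiuniformity [TopologicalSpace Y] (U : UniformSpace Y) : Prop :=
  IsEquiuniformity G U ∧ IsTotallyBounded U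

/-- `𝔈_α(U)`: the uniformity on `G` induced by the uniformity of pointwise convergence on `Y ^ Y`
(each factor carrying `U`) under `g ↦ (y ↦ g • y)`. -/
def ellisUnif (U : UniformSpace Y) : UniformSpace G :=
  UniformSpace.comap (fun (g : G) (y : Y) => g • y) (@Pi.uniformSpace Y (fun _ => Y) (fun _ => U))

/-- `𝔈~_α(U)`: the uniformity on `G` induced by the uniformity of pointwise convergence on
`Ỹ ^ Ỹ` under `g ↦ (p ↦ α~(g, p))`, where `Ỹ` is the completion of `(Y, U)` and `α~` is the
extended action. -/
def ellisUnifExt (U : UniformSpace Y) : UniformSpace G :=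
  UniformSpace.comap (fun (g : G) (p : UCompl U) => UCompl.map U (fun y => g • y) p)
    (Pi.uniformSpace (fun _ : UCompl U => UCompl U))

end Equi

/-! ### Uniformities on a topological group -/

section GroupUnif

variable (G : Type*) [Group G] [TopologicalSpace G] [IsTopologicalGroup G]

/-- The Roelcke uniformity `L ∧ R`: the finest uniformity which is coarser than both the left
and the right uniformity. -/
def roelcke : UniformSpace G :=
  IsTopologicalGroup.leftUniformSpace G ⊔ IsTopologicalGroup.rightUniformSpace G

variable (Y : Type*) [MulAction G Y]

/-- The entourages `{(g, h) | h ∈ O g St_σ}`. -/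
def stabEntourage (O : Set G) (σ : Finset Y) : Set (G × G) :=
  {p | ∃ o ∈ O, ∃ s ∈ fixingSubgroup G (σ : Set Y), p.2 = o * p.1 * s}

/-- The filter with base `{(g, h) | h ∈ O g St_σ}`, `O ∈ 𝓝 1`, `σ ⊆ Y` finite. -/
def stabFilter : Filter (G × G) :=
  ⨅ i : {O : Set G // O ∈ 𝓝 (1 : G)} × Finset Y, 𝓟 (stabEntourage G Y i.1.1 i.2)

theorem stabEntourage_mono {G Y : Type*} [Group G] [MulAction G Y] {O O' : Set G} {σ σ' : Finset Y} (hO : O ⊆ O') (hσ : σ' ⊆ σ) :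
    stabEntourage G Y O σ ⊆ stabEntourage G Y O' σ' := by
  rintro p ⟨o, ho, s, hs, h⟩
  exact ⟨o, hO ho, s, fixingSubgroup_antitone G Y (Finset.coe_subset.2 hσ) hs, h⟩

theorem stabFilter_hasBasis :
    (stabFilter G Y).HasBasis (fun i : Set G × Finset Y => i.1 ∈ 𝓝 (1 : G))
      (fun i => stabEntourage G Y i.1 i.2) := by
  classical
  have : Nonempty ({O : Set G // O ∈ 𝓝 (1 : G)} × Finset Y) := ⟨⟨⟨Set.univ, univ_mem⟩, ∅⟩⟩
  have hd : Directed (· ≥ ·) (fun i : {O : Set G // O ∈ 𝓝 (1 : G)} × Finset Y =>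
      stabEntourage G Y i.1.1 i.2) := by
    rintro ⟨⟨O, hO⟩, σ⟩ ⟨⟨O', hO'⟩, σ'⟩
    exact ⟨⟨⟨O ∩ O', inter_mem hO hO'⟩, σ ∪ σ'⟩,
      stabEntourage_mono Set.inter_subset_left Finset.subset_union_left,
      stabEntourage_mono Set.inter_subset_right Finset.subset_union_right⟩
  refine ⟨fun t => ((hasBasis_iInf_principal hd).mem_iff).trans ⟨?_, ?_⟩⟩
  · rintro ⟨i, -, h⟩
    exact ⟨(i.1.1, i.2), i.1.2, h⟩
  · rintro ⟨i, hi, h⟩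
    exact ⟨(⟨i.1, hi⟩, i.2), trivial, h⟩

/-- The uniformity `R_{Σ_Y}` on `G` from the family of stabilizers of finite subsets of `Y`. Its
uniform covers have the base `{O g St_σ | g ∈ G}`, `O ∈ 𝓝 1`, `σ ⊆ Y` finite. -/
def stabUnif : UniformSpace G :=
  UniformSpace.ofCore
    { uniformity := stabFilter G Y
      refl := by
        refine (stabFilter_hasBasis G Y).ge_iff.2 fun i hi => ?_
        rintro ⟨g, h⟩ (rfl : g = h)
        exact ⟨1, mem_of_mem_nhds hi, 1, one_mem _, by simp⟩
      symm := by
        refine ((stabFilter_hasBasis G Y).tendsto_iff (stabFilter_hasBasis G Y)).2 fun i hi =>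
          ⟨(i.1⁻¹, i.2), inv_mem_nhds_one G hi, ?_⟩
        rintro ⟨g, h⟩ ⟨o, ho, s, hs, e⟩
        refine ⟨o⁻¹, ho, s⁻¹, inv_mem hs, ?_⟩
        simp only [Prod.fst_swap, Prod.snd_swap] at e ⊢
        rw [e]; group
      comp := by
        refine (stabFilter_hasBasis G Y).ge_iff.2 fun i hi => ?_
        obtain ⟨V, hV, hVV⟩ := exists_nhds_one_split hi
        refine mem_of_superset (mem_lift' ((stabFilter_hasBasis G Y).mem_of_mem (i := (V, i.2)) hV))
          ?_
        rintro ⟨g, h⟩ ⟨k, ⟨o, ho, s, hs, e⟩, ⟨o', ho', s', hs', e'⟩⟩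
        refine ⟨o' * o, hVV _ ho' _ ho, s * s', mul_mem hs hs', ?_⟩
        simp only at e e' ⊢
        rw [e', e]; group }

end GroupUnif

/-! ### Proper enveloping Ellis semigroup compactifications -/

section Ellis

variable (G : Type*) [Group G] [TopologicalSpace G]

/-- `(S, s)` is a proper enveloping Ellis semigroup compactification of `G`. -/
structure IsEllisCompactification (S : Type*) [TopologicalSpace S] [Semigroup S] (s : G → S) :
    Prop where
  compact : CompactSpace S
  t2 : T2Space S
  right_topological : ∀ y : S, Continuous (fun x : S => x * y)
  map_mul : ∀ g h : G, s (g * h) = s g * s h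
  isEmbedding : IsEmbedding s
  denseRange : DenseRange s
  continuousOn_mul : ContinuousOn (fun p : S × S => p.1 * p.2) (Set.range s ×ˢ Set.univ)

/-- An Ellis equiuniformity on `G`: a totally bounded equiuniformity (for the action of `G` on
itself by left multiplication) such that the completion of `G` is a proper enveloping Ellis
semigroup compactification of `G`. -/
def IsEllisEquiuniformity (U : UniformSpace G) : Prop :=
  IsTBEquiuniformity G U ∧
    ∃ m : Semigroup (UCompl U), @IsEllisCompactification G _ _ (UCompl U) _ m (UCompl.coe U)

end Ellis

/-! ### Chains -/

section Chain

variable (X : Type u) [LinearOrder X]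

/-- Finite increasing sequences can be mapped onto each other by automorphisms. -/
def IsUltrahomogeneous : Prop :=
  ∀ (n : ℕ) (x y : Fin n → X), StrictMono x → StrictMono y →
    ∃ g : X ≃o X, ∀ k, g (x k) = y k

/-- A gap `(A, B)` of the chain, given by its lower class `A` (`B` is the complement of `A`):
`A` has no largest element and `B` has no least element. Improper gaps (`A` or `B` empty) are
allowed. -/
@[ext]
structure Gap where
  lower : LowerSet X
  noMax : ∀ a ∈ lower, ∃ b ∈ lower, a < b
  noMin : ∀ a ∉ lower, ∃ b ∉ lower, b < a

variable {X} in
/-- Both classes of the gap are nonempty. -/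
def Gap.IsProper (A : Gap X) : Prop :=
  (∃ a, a ∈ A.lower) ∧ (∃ b, b ∉ A.lower)

/-- A chain without proper gaps is called continuous. -/
def IsContinuousChain : Prop :=
  ∀ A : Gap X, ¬ A.IsProper

/-- The underlying set of `b_m X`: the points of `X × {-1, 0, 1}` and the gaps of `X`. -/
inductive BM
  | pt (x : X) (j : SignType) : BM
  | gap (A : Gap X) : BM

namespace BM

variable {X}

/-- The natural order: lexicographic on `X × {-1, 0, 1}`, a gap `(A, B)` lies above the points
over `A` and below the points over `B`. -/
protected def le : BM X → BM X → Prop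
  | pt x i, pt y j => x < y ∨ (x = y ∧ i ≤ j)
  | pt x _, gap A => x ∈ A.lower
  | gap A, pt x _ => x ∉ A.lower
  | gap A, gap B => A.lower ≤ B.lower

instance : LinearOrder (BM X) where
  le := BM.le
  le_refl p := by
    cases p with
    | pt x i => exact Or.inr ⟨rfl, le_rfl⟩
    | gap A => exact le_refl A.lower
  le_trans p q r hpq hqr := by
    cases p with
    | pt x i =>
      cases q with
      | pt y j =>
        cases r with
        | pt z k =>
          rcases hpq with h | ⟨rfl, h⟩
          · rcases hqr with h' | ⟨rfl, _⟩
            · exact Or.inl (h.trans h')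
            · exact Or.inl h
          · rcases hqr with h' | ⟨rfl, h'⟩
            · exact Or.inl h'
            · exact Or.inr ⟨rfl, h.trans h'⟩
        | gap C =>
          rcases hpq with h | ⟨rfl, _⟩
          · exact C.lower.lower h.le hqr
          · exact hqr
      | gap B =>
        cases r with
        | pt z k =>
          exact Or.inl (lt_of_not_ge fun h => hqr (B.lower.lower h hpq))
        | gap C => exact hqr hpq
    | gap A =>
      cases q with
      | pt y j =>
        cases r with
        | pt z k =>
          rcases hqr with h | ⟨rfl, _⟩
          · exact fun hz => hpq (A.lower.lower h.le hz)
          · exact hpq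
        | gap C =>
          intro a ha
          exact C.lower.lower (lt_of_not_ge fun h => hpq (A.lower.lower h ha)).le hqr
      | gap B =>
        cases r with
        | pt z k => exact fun hz => hqr (hpq hz)
        | gap C => exact le_trans (α := LowerSet X) hpq hqr
  le_antisymm p q hpq hqp := by
    cases p with
    | pt x i =>
      cases q with
      | pt y j =>
        rcases hpq with h | ⟨rfl, h⟩
        · rcases hqp with h' | ⟨rfl, _⟩
          · exact absurd h h'.not_gt
          · exact absurd h (lt_irrefl _)
        · rcases hqp with h' | ⟨_, h'⟩
          · exact absurd h' (lt_irrefl _)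
          · rw [le_antisymm h h']
      | gap B => exact absurd hpq hqp
    | gap A =>
      cases q with
      | pt y j => exact absurd hqp hpq
      | gap B => exact congrArg gap (Gap.ext (le_antisymm (α := LowerSet X) hpq hqp))
  le_total p q := by
    cases p with
    | pt x i =>
      cases q with
      | pt y j =>
        rcases lt_trichotomy x y with h | rfl | h
        · exact Or.inl (Or.inl h)
        · rcases le_total i j with h | h
          · exact Or.inl (Or.inr ⟨rfl, h⟩)
          · exact Or.inr (Or.inr ⟨rfl, h⟩)
        · exact Or.inr (Or.inl h)
      | gap B => exact Classical.em _
    | gap A =>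
      cases q with
      | pt y j => exact (Classical.em _).symm
      | gap B => exact le_total A.lower B.lower
  toDecidableLE := Classical.decRel _

/-- `b_m X` carries the order topology. -/
instance : TopologicalSpace (BM X) := Preorder.topology (BM X)

instance : OrderTopology (BM X) := ⟨rfl⟩

/-- `p ∈ X` for a point `p` of `b_m X`, where `X` is identified with `X × {0}`. -/
def MemX (p : BM X) : Prop := ∃ x : X, p = pt x 0

end BM

/-- `(K, k)` is a linearly ordered compactification of the chain `X` with its given topology: `K`
is a chain which is compact in its order topology, `k` is an order-preserving topological
embedding with dense image. -/
structure IsLOCompactification {X : Type u} [LinearOrder X] [TopologicalSpace X]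
    (K : Type u) [LinearOrder K] [TopologicalSpace K] (k : X → K) : Prop where
  orderTopology : OrderTopology K
  compact : CompactSpace K
  strictMono : StrictMono k
  isEmbedding : IsEmbedding k
  denseRange : DenseRange k

/-- `(K, k)` is the smallest linearly ordered compactification of `X`. -/
def IsMinimalLOCompactification {X : Type u} [LinearOrder X] [TopologicalSpace X]
    (K : Type u) [LinearOrder K] [TopologicalSpace K] (k : X → K) : Prop :=
  IsLOCompactification K k ∧
    ∀ (K' : Type u) [LinearOrder K'] [TopologicalSpace K'] (k' : X → K'),
      IsLOCompactification K' k' → ∃ φ : K' → K, Continuous φ ∧ ∀ x, φ (k' x) = k x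

/-! ### The automorphism group of a chain -/

variable {X}

/-- The permutation topology on `Aut(X)`, with the subbase `{g | g x = y}`, `x, y ∈ X`. -/
instance permutationTopology : TopologicalSpace (X ≃o X) :=
  TopologicalSpace.generateFrom {S | ∃ x y : X, S = {g : X ≃o X | g x = y}}

theorem isOpen_setOf_apply_eq (x y : X) : IsOpen {g : X ≃o X | g x = y} :=
  TopologicalSpace.isOpen_generateFrom_of_mem ⟨x, y, rfl⟩

instance : IsTopologicalGroup (X ≃o X) where
  continuous_mul := by
    refine continuous_generateFrom_iff.2 ?_
    rintro _ ⟨x, y, rfl⟩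
    have : (fun p : (X ≃o X) × (X ≃o X) => p.1 * p.2) ⁻¹' {g | g x = y} =
        ⋃ z, {g : X ≃o X | g z = y} ×ˢ {g : X ≃o X | g x = z} := by
      ext ⟨g, h⟩
      simp
    rw [this]
    exact isOpen_iUnion fun z => (isOpen_setOf_apply_eq z y).prod (isOpen_setOf_apply_eq x z)
  continuous_inv := by
    refine continuous_generateFrom_iff.2 ?_
    rintro _ ⟨x, y, rfl⟩
    have : (fun g : X ≃o X => g⁻¹) ⁻¹' {g | g x = y} = {g : X ≃o X | g y = x} := by
      ext g
      exact (OrderIso.symm_apply_eq g).trans eq_comm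
    rw [this]
    exact isOpen_setOf_apply_eq y x

/-- The image `(g A, g B)` of a gap `(A, B)`. -/
def Gap.map (g : X ≃o X) (A : Gap X) : Gap X where
  lower := LowerSet.map g A.lower
  noMax := by
    rintro _ ⟨a, ha, rfl⟩
    obtain ⟨b, hb, hab⟩ := A.noMax a ha
    exact ⟨g b, ⟨b, hb, rfl⟩, g.strictMono hab⟩
  noMin := by
    intro a ha
    obtain ⟨b, hb, hab⟩ := A.noMin (g.symm a) fun h => ha ⟨_, h, g.apply_symm_apply a⟩
    refine ⟨g b, ?_, by simpa using g.strictMono hab⟩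
    rintro ⟨c, hc, e⟩
    exact hb (g.injective e ▸ hc)

/-- The action of `Aut(X)` on `b_m X`: `g (x, j) = (g x, j)`, `g (A, B) = (g A, g B)`. -/
def BM.act (g : X ≃o X) : BM X → BM X
  | BM.pt x j => BM.pt (g x) j
  | BM.gap A => BM.gap (A.map g)

instance : MulAction (X ≃o X) (BM X) where
  smul := BM.act
  one_smul p := by
    cases p with
    | pt x j => rfl
    | gap A =>
      refine congrArg BM.gap (Gap.ext (SetLike.ext fun x => ?_))
      exact ⟨fun ⟨a, ha, e⟩ => e ▸ ha, fun h => ⟨x, h, rfl⟩⟩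
  mul_smul g h p := by
    cases p with
    | pt x j => rfl
    | gap A =>
      refine congrArg BM.gap (Gap.ext (SetLike.ext fun x => ?_))
      exact ⟨fun ⟨a, ha, e⟩ => ⟨h a, ⟨a, ha, rfl⟩, e⟩,
        fun ⟨_, ⟨a, ha, e'⟩, e⟩ => ⟨a, ha, by rw [← e, ← e']; rfl⟩⟩

variable (X)

/-- Conditions (i)-(v) on a self-map of `b_m X`; `inf` and `sup` are the least and the greatest
points of `b_m X`. -/
structure IsEllisMap (f : BM X → BM X) : Prop where
  monotone : Monotone f
  not_mem_of_not_mem : ∀ p, ¬ p.MemX → ¬ (f p).MemX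
  not_mem_of_eq : ∀ p q, f p = f q → p ≠ q → ¬ (f p).MemX
  triple : ∀ x : X,
    (f (BM.pt x (-1)) = f (BM.pt x 0) ∧ f (BM.pt x 0) = f (BM.pt x 1) ∧
      ¬ (f (BM.pt x 0)).MemX) ∨
    ∃ y : X, ∀ j : SignType, f (BM.pt x j) = BM.pt y j
  map_inf : ∀ p, IsBot p → f p = p
  map_sup : ∀ p, IsTop p → f p = p

/-- The set of self-maps of `b_m X` satisfying (i)-(v), in the topology of pointwise
convergence. -/
abbrev EllisMaps : Type _ := {f : BM X → BM X // IsEllisMap X f}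

/-- The set of monotone maps `X → b_m X` satisfying (ii'), in the topology of pointwise
convergence. -/
abbrev RoelckeMaps : Type _ :=
  {f : X → BM X // Monotone f ∧ ∀ x y, f x = f y → x ≠ y → ¬ (f x).MemX}

end Chain

end ChainEllis

end

open ChainEllis

/-!
The proof describes every space in sight by positions. A point `p` of `b_m X` is determined by the
function `BM.cut p : X → Ordering` recording whether `p` lies below, at or above each `x ∈ X`, and
the functions that occur are exactly those which are consistent on pairs (`BM.range_cut`). Hence
`b_m X` is a closed subspace of a product of three-point discrete spaces (`BM.isEmbedding_cut`,
`BM.isClosed_range_cut`); it is compact, and its entourages only test the positions of points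
relative to finitely many elements of `X`. The same position functions make sense in every linearly
ordered compactification of `X`, which is why `b_m X` is the smallest one.

All uniformities of the theorem are induced by maps into compact powers of `b_m X`: the maximal
equiuniformity by `X → b_m X`, the Roelcke uniformity by `g ↦ (x ↦ g x) ∈ (b_m X) ^ X`, and
`R_{Σ_{b_m X}}` by `g ↦ (p ↦ g p) ∈ (b_m X) ^ (b_m X)`. As the group acts continuously on these
compact spaces, they are totally bounded equiuniformities (`isTBEquiuniformity_comap`), and their
completions are the closures of the images.

Two facts about ultrahomogeneous chains carry the argument.

* If an automorphism `f` preserves the positions of finitely many points of `b_m X` relative to a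
  finite set `τ ⊆ X`, then some automorphism fixing `τ` agrees with `f` on these points
  (`IsUltrahomogeneous.exists_fixing_smul_eq`). This identifies the uniformities given by
  stabilizers with those of pointwise convergence (`IsUltrahomogeneous.stabUnif_eq_comap`).
* The automorphisms are pointwise dense in the monotone maps `X → b_m X` that are injective over `X`
  (`IsUltrahomogeneous.exists_cut_eq`), and from this in the set `EllisMaps X`
  (`IsUltrahomogeneous.exists_cut_smul_eq`). Both sets of maps are closed, so they are the
  completions.

The Roelcke compactification contains the constant maps with values outside `X`, so pointwise
convergence on it is pointwise convergence on `b_m X` (`IsUltrahomogeneous.ellisUnifExt_roelcke`).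
An Ellis equiuniformity contains the uniformity of pointwise convergence on its completion
(`IsEllisEquiuniformity.le_ellisUnifExt`), and therefore the Roelcke uniformity can be one only if
it equals `R_{Σ_{b_m X}}`. For a continuous chain every point of `b_m X` other than the two end points
lies over a point of `X`, and the two uniformities coincide.
-/

noncomputable section

namespace ChainEllis

universe u

/-! ### Uniformities induced by maps into compact spaces -/

section Completion

variable {Y K : Type*} [UniformSpace K]

theorem UCompl.denseRange_coe (U : UniformSpace Y) : DenseRange (UCompl.coe U) :=
  @UniformSpace.Completion.denseRange_coe Y U

theorem UCompl.isUniformInducing_coe (U : UniformSpace Y) :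
    @IsUniformInducing Y (UCompl U) U _ (UCompl.coe U) :=
  @UniformSpace.Completion.isUniformInducing_coe Y U

instance (U : UniformSpace Y) : T2Space (UCompl U) :=
  inferInstanceAs (T2Space (@UniformSpace.Completion Y U))

instance (U : UniformSpace Y) : CompleteSpace (UCompl U) :=
  inferInstanceAs (CompleteSpace (@UniformSpace.Completion Y U))

/-- A complete Hausdorff space which contains `Y` densely and induces `U` is the completion of
`(Y, U)`. -/
theorem UCompl.exists_uniformEquiv [CompleteSpace K] [T0Space K] {U : UniformSpace Y} {e : Y → K}
    (hU : U = UniformSpace.comap e ‹_›) (he : DenseRange e) :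
    ∃ Φ : UCompl U ≃ᵤ K, ∀ y, Φ (UCompl.coe U y) = e y := by
  have hi : IsUniformInducing e := ⟨by rw [hU]; rfl⟩
  let pkg : AbstractCompletion Y := ⟨K, e, ‹_›, ‹_›, ‹_›, hi, he⟩
  exact ⟨UniformSpace.Completion.cPkg.compareEquiv pkg,
    fun y => UniformSpace.Completion.cPkg.compare_coe pkg y⟩

theorem UCompl.exists_homeomorph_of_eq {U V : UniformSpace Y} (h : U = V) :
    ∃ Θ : UCompl U ≃ₜ UCompl V, ∀ y, Θ (UCompl.coe U y) = UCompl.coe V y := by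
  subst h
  exact ⟨Homeomorph.refl _, fun _ => rfl⟩

/-- The extension of `f` to the completion is the only continuous map that extends `f`. -/
theorem UCompl.apply_map [T2Space K] {U : UniformSpace Y} {e : Y → K} {Φ : UCompl U → K}
    (hΦ : Continuous Φ) (hΦe : ∀ y, Φ (UCompl.coe U y) = e y) {f : Y → Y}
    (hf : @UniformContinuous Y Y U U f) {F : K → K} (hF : Continuous F)
    (hFe : ∀ y, F (e y) = e (f y)) (p : UCompl U) : Φ (UCompl.map U f p) = F (Φ p) := by
  have hm : Continuous (UCompl.map U f) := @UniformSpace.Completion.continuous_map Y U Y U f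
  refine congrFun ((UCompl.denseRange_coe U).equalizer (hΦ.comp hm) (hF.comp hΦ) ?_) p
  funext y
  have : UCompl.map U f (UCompl.coe U y) = UCompl.coe U (f y) :=
    @UniformSpace.Completion.map_coe Y U Y U f hf y
  simp [this, hΦe, hFe]

end Completion

section Equiuniformity

variable {G : Type*} [Group G] {Y K : Type*} [MulAction G Y]
  [UniformSpace K] [MulAction G K]

/-- An equivariant topological embedding into a compact space with a continuous action induces a
totally bounded equiuniformity. Boundedness is the tube lemma: elements of `G` close to `1` move
all points of `K` by a small amount. -/
theorem isTBEquiuniformity_comap [TopologicalSpace G] [CompactSpace K]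
    [ContinuousSMul G K] [TopologicalSpace Y] {e : Y → K} (he : IsInducing e)
    (hsmul : ∀ (g : G) y, e (g • y) = g • e y) :
    IsTBEquiuniformity G (UniformSpace.comap e ‹_›) := by
  refine ⟨⟨?_, fun g => ?_, ?_⟩, ?_⟩
  · exact he.eq_induced.symm
  · let : UniformSpace Y := UniformSpace.comap e ‹_›
    refine uniformContinuous_comap' ?_
    have : e ∘ (fun y : Y => g • y) = (fun k => g • k) ∘ e := funext fun y => hsmul g y
    rw [this]
    exact (CompactSpace.uniformContinuous_of_continuous (continuous_const_smul g)).comp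
      uniformContinuous_comap
  · rintro c ⟨V, ⟨W, hW, hWV⟩, hV⟩
    obtain ⟨W', hW', hWW'⟩ := comp_mem_uniformity_sets hW
    have hO : ∀ᶠ g in 𝓝 (1 : G), ∀ k ∈ (Set.univ : Set K), (k, g • k) ∈ W' := by
      refine isCompact_univ.eventually_forall_of_forall_eventually fun k _ => ?_
      have hc : Continuous fun z : G × K => (z.2, z.1 • z.2) := by fun_prop
      refine hc.continuousAt.eventually_mem ?_
      simpa using nhds_le_uniformity k hW'
    refine ⟨_, hO, Set.range fun y => {z | (e y, e z) ∈ W'},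
      ⟨_, preimage_mem_comap hW', fun y => ⟨_, ⟨y, rfl⟩, subset_rfl⟩⟩, ?_⟩
    rintro _ ⟨y, rfl⟩
    obtain ⟨C, hC, hVC⟩ := hV y
    refine ⟨C, hC, fun g hg z hz => hVC (hWV ?_)⟩
    refine hWW' ⟨e z, hz, ?_⟩
    rw [hsmul]
    exact hg _ trivial
  · let : UniformSpace Y := UniformSpace.comap e ‹_›
    exact totallyBounded_preimage ⟨rfl⟩ (isCompact_univ (X := K)).totallyBounded

/-- The uniformity of pointwise convergence on the completion can be computed on any model `K` of
the completion. -/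
theorem ellisUnifExt_eq_comap [T2Space K] [ContinuousConstSMul G K] {U : UniformSpace Y}
    {e : Y → K} (Φ : UCompl U ≃ᵤ K) (hΦ : ∀ y, Φ (UCompl.coe U y) = e y)
    (hU : ∀ g : G, @UniformContinuous Y Y U U (fun y => g • y))
    (hsmul : ∀ (g : G) y, e (g • y) = g • e y) :
    ellisUnifExt G U =
      UniformSpace.comap (fun (g : G) (k : K) => g • k) (Pi.uniformSpace fun _ : K => K) := by
  have key : ∀ (g : G) (p : UCompl U), Φ (UCompl.map U (fun y => g • y) p) = g • Φ p :=
    fun g => UCompl.apply_map Φ.continuous hΦ (hU g) (continuous_const_smul g)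
      (fun y => (hsmul g y).symm)
  have h := Φ.isUniformInducing.comap_uniformSpace
  rw [ellisUnifExt, Pi.uniformSpace_eq, Pi.uniformSpace_eq, UniformSpace.comap_iInf,
    UniformSpace.comap_iInf, ← Φ.toEquiv.iInf_congr]
  intro p
  rw [← UniformSpace.comap_comap, ← UniformSpace.comap_comap]
  refine Eq.trans ?_ (congrArg (UniformSpace.comap _) h)
  rw [← UniformSpace.comap_comap]
  congr 1
  funext g
  exact (key g p).symm

/-- In an Ellis compactification all right multiplications are continuous, so that `g ↦ s g * f`
is uniformly continuous: the uniformity contains that of pointwise convergence on its completion. -/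
theorem IsEllisEquiuniformity.le_ellisUnifExt [TopologicalSpace G] {U : UniformSpace G}
    (h : IsEllisEquiuniformity G U) : U ≤ ellisUnifExt G U := by
  obtain ⟨⟨hU, -⟩, m, hm⟩ := h
  have := hm.compact
  have hmap : ∀ (g : G) (p : UCompl U),
      UCompl.map U (fun y => g • y) p = UCompl.coe U g * p := fun g =>
    UCompl.apply_map (Φ := id) continuous_id (fun _ => rfl) (hU.saturated g)
      (hm.continuousOn_mul.comp_continuous (by fun_prop : Continuous fun p => (UCompl.coe U g, p))
        fun p => ⟨⟨g, rfl⟩, trivial⟩) fun y => (hm.map_mul g y).symm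
  rw [ellisUnifExt, Pi.uniformSpace_eq, UniformSpace.comap_iInf]
  refine le_iInf fun p => ?_
  rw [← UniformSpace.comap_comap]
  refine uniformContinuous_iff_le_comap.1 ?_
  have h2 : UniformContinuous fun x : UCompl U => x * p :=
    CompactSpace.uniformContinuous_of_continuous (hm.right_topological p)
  have h3 := h2.comp (UCompl.isUniformInducing_coe U).uniformContinuous
  convert h3 using 1
  funext g
  exact hmap g p

end Equiuniformity

/-- Ellis semigroup structures can be transported along homeomorphisms over the group. -/
theorem IsEllisCompactification.exists_of_homeomorph {G S T : Type*} [Group G]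
    [TopologicalSpace G] [TopologicalSpace S] [TopologicalSpace T] [m : Semigroup S] {s : G → S}
    {t : G → T} (h : IsEllisCompactification G S s) (Φ : T ≃ₜ S) (hΦ : ∀ g, Φ (t g) = s g) :
    ∃ m' : Semigroup T, @IsEllisCompactification G _ _ T _ m' t := by
  have ht : t = Φ.symm ∘ s := funext fun g => by simp [← hΦ]
  let m' : Semigroup T := Φ.toEquiv.semigroup
  have hmul : ∀ a b : T, Φ (a * b) = Φ a * Φ b := fun a b => Φ.apply_symm_apply _
  have hmul' : ∀ a b : T, a * b = Φ.symm (Φ a * Φ b) := fun a b => rfl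
  have := h.compact
  have := h.t2
  refine ⟨m', Φ.symm.compactSpace, Φ.symm.t2Space, fun y => ?_, fun g k => ?_, ?_, ?_, ?_⟩
  · exact Φ.symm.continuous.comp ((h.right_topological (Φ y)).comp Φ.continuous)
  · exact Φ.injective (by rw [hmul, hΦ, hΦ, hΦ, h.map_mul])
  · exact ht ▸ Φ.symm.isEmbedding.comp h.isEmbedding
  · exact ht ▸ Φ.symm.surjective.denseRange.comp h.denseRange Φ.symm.continuous
  · simp only [hmul']
    refine Φ.symm.continuous.comp_continuousOn (h.continuousOn_mul.comp
      (f := fun p : T × T => (Φ p.1, Φ p.2)) (by fun_prop) ?_)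
    rintro ⟨_, b⟩ ⟨⟨g, rfl⟩, -⟩
    exact ⟨⟨g, (hΦ g).symm⟩, trivial⟩

/-! ### The compactification `b_m X` -/

/-- `Ordering` carries the discrete uniformity. -/
instance : UniformSpace Ordering := ⊥

instance : DiscreteTopology Ordering := ⟨rfl⟩

variable {X : Type u} [LinearOrder X]

namespace BM

theorem pt_le_pt {x y : X} {i j : SignType} : pt x i ≤ pt y j ↔ x < y ∨ x = y ∧ i ≤ j := Iff.rfl

theorem pt_le_gap {x : X} {i : SignType} {A : Gap X} : pt x i ≤ gap A ↔ x ∈ A.lower := Iff.rfl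

theorem gap_le_pt {x : X} {i : SignType} {A : Gap X} : gap A ≤ pt x i ↔ x ∉ A.lower := Iff.rfl

theorem pt_lt_pt {x y : X} {i j : SignType} : pt x i < pt y j ↔ x < y ∨ x = y ∧ i < j := by
  rw [← not_le, pt_le_pt]
  rcases lt_trichotomy x y with h | rfl | h
  · simp [h, h.not_gt, h.ne']
  · simp
  · simp [h, h.not_gt, h.ne']

theorem pt_lt_gap {x : X} {i : SignType} {A : Gap X} : pt x i < gap A ↔ x ∈ A.lower := by
  rw [← not_le, gap_le_pt, not_not]

theorem gap_lt_pt {x : X} {i : SignType} {A : Gap X} : gap A < pt x i ↔ x ∉ A.lower := by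
  rw [← not_le, pt_le_gap]

/-- The position of a point of `b_m X` relative to the points of `X`. It determines the point, and
the topology of `b_m X` is the topology of pointwise convergence of positions. -/
def cut (p : BM X) (x : X) : Ordering := cmp p (pt x 0)

theorem cut_eq_lt {p : BM X} {x : X} : cut p x = .lt ↔ p < pt x 0 := cmp_eq_lt_iff _ _

theorem cut_eq_eq {p : BM X} {x : X} : cut p x = .eq ↔ p = pt x 0 := cmp_eq_eq_iff _ _

theorem cut_eq_gt {p : BM X} {x : X} : cut p x = .gt ↔ pt x 0 < p := cmp_eq_gt_iff _ _

theorem cut_pt_zero (x y : X) : cut (pt x 0) y = cmp x y :=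
  StrictMono.cmp_map_eq (f := fun x : X => pt x 0) (fun _ _ h => pt_lt_pt.2 (Or.inl h)) x y

theorem isOpen_singleton_pt (x : X) : IsOpen {(pt x 0 : BM X)} := by
  have : {(pt x 0 : BM X)} = Set.Ioo (pt x (-1)) (pt x 1) := by
    ext p
    refine ⟨?_, fun ⟨h1, h2⟩ => ?_⟩
    · rintro rfl
      simp only [Set.mem_Ioo, pt_lt_pt, lt_irrefl, true_and, false_or]
      decide
    · cases p with
      | pt y j =>
        rw [pt_lt_pt] at h1 h2
        obtain h1 | ⟨rfl, h1⟩ := h1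
        · obtain h2 | ⟨rfl, h2⟩ := h2
          · exact absurd h1 h2.not_gt
          · exact absurd h1 (lt_irrefl _)
        · obtain h2 | ⟨-, h2⟩ := h2
          · exact absurd h2 (lt_irrefl _)
          · have : ∀ j : SignType, -1 < j → j < 1 → j = 0 := by decide
            rw [this j h1 h2]; rfl
      | gap A => exact absurd (pt_lt_gap.1 h1) (gap_lt_pt.1 h2)
  rw [this]
  exact isOpen_Ioo

/-- Points of `b_m X` are separated by points of `X`. -/
theorem exists_pt_mem_Icc [DenselyOrdered X] {p q : BM X} (h : p < q) :
    ∃ x, p ≤ pt x 0 ∧ pt x 0 ≤ q := by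
  cases p with
  | pt x i =>
    cases q with
    | pt y j =>
      obtain h | ⟨rfl, hij⟩ := pt_lt_pt.1 h
      · obtain ⟨z, h1, h2⟩ := exists_between h
        exact ⟨z, Or.inl h1, Or.inl h2⟩
      · have : ∀ i j : SignType, i < j → i ≤ 0 ∧ 0 ≤ j := by decide
        obtain ⟨h1, h2⟩ := this i j hij
        exact ⟨x, Or.inr ⟨rfl, h1⟩, Or.inr ⟨rfl, h2⟩⟩
    | gap B =>
      obtain ⟨y, hy, hxy⟩ := B.noMax x (pt_lt_gap.1 h)
      exact ⟨y, Or.inl hxy, hy⟩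
  | gap A =>
    cases q with
    | pt y j =>
      obtain ⟨x, hx, hxy⟩ := A.noMin y (gap_lt_pt.1 h)
      exact ⟨x, hx, Or.inl hxy⟩
    | gap B =>
      obtain ⟨x, hx, hx'⟩ := Set.not_subset.1 (not_le_of_gt h)
      exact ⟨x, hx', hx⟩

theorem cut_injective [DenselyOrdered X] : Function.Injective (cut : BM X → X → Ordering) := by
  have key : ∀ p q : BM X, p < q → cut p ≠ cut q := by
    intro p q h e
    obtain ⟨x, h1, h2⟩ := exists_pt_mem_Icc h
    obtain h1 | h1 := h1.lt_or_eq
    · exact (cut_eq_lt.1 (congrFun e x ▸ cut_eq_lt.2 h1)).not_ge h2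
    · exact h.ne (h1.trans (cut_eq_eq.1 (congrFun e x ▸ cut_eq_eq.2 h1)).symm)
  intro p q e
  by_contra hne
  obtain h | h := lt_or_gt_of_ne hne
  · exact key _ _ h e
  · exact key _ _ h e.symm

/-- A function is a system of positions as soon as it is consistent on pairs. It belongs to `pt x 0`
if it takes the value `.eq` at `x`; otherwise it cuts `X` in two, and it belongs to `pt x 1` if `x`
is the greatest element of the lower class, to `pt x (-1)` if `x` is the least element of the
upper class, and to a gap in the remaining case. -/
theorem range_cut [DenselyOrdered X] : Set.range (cut : BM X → X → Ordering) =
    {f | ∀ x y, x < y → f x = .gt ∨ f y = .lt} := by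
  ext f
  constructor
  · rintro ⟨p, rfl⟩ x y h
    rw [cut_eq_gt, cut_eq_lt]
    have : (pt x 0 : BM X) < pt y 0 := pt_lt_pt.2 (Or.inl h)
    by_contra! hc
    exact (hc.2.trans hc.1).not_gt this
  · intro hf
    have hlow : ∀ x y, x < y → f y ≠ .lt → f x = .gt := fun x y h => (hf x y h).resolve_right
    have hup : ∀ x y, x < y → f x ≠ .gt → f y = .lt := fun x y h => (hf x y h).resolve_left
    by_cases h0 : ∃ x, f x = .eq
    · obtain ⟨x, hx⟩ := h0
      refine ⟨pt x 0, funext fun y => ?_⟩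
      rw [cut_pt_zero]
      rcases lt_trichotomy x y with h | rfl | h
      · rw [hup x y h (by simp [hx]), cmp_eq_lt_iff]; exact h
      · rw [hx, cmp_self_eq_eq]
      · rw [hlow y x h (by simp [hx]), cmp_eq_gt_iff]; exact h
    · push Not at h0
      have hcase : ∀ x, f x ≠ .gt → f x = .lt := fun x h => by
        cases hx : f x <;> simp_all
      by_cases hmax : ∃ x, f x = .gt ∧ ∀ y, x < y → f y = .lt
      · obtain ⟨x, hx, hy⟩ := hmax
        refine ⟨pt x 1, funext fun y => ?_⟩
        rcases lt_or_ge x y with h | h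
        · rw [hy y h, cut_eq_lt]; exact pt_lt_pt.2 (Or.inl h)
        · have : f y = .gt := by
            obtain h | rfl := h.lt_or_eq
            · exact hlow y x h (by simp [hx])
            · exact hx
          rw [this, cut_eq_gt, pt_lt_pt]
          exact h.lt_or_eq.imp id fun h => ⟨h, by decide⟩
      by_cases hmin : ∃ x, f x = .lt ∧ ∀ y, y < x → f y = .gt
      · obtain ⟨x, hx, hy⟩ := hmin
        refine ⟨pt x (-1), funext fun y => ?_⟩
        rcases lt_or_ge y x with h | h
        · rw [hy y h, cut_eq_gt]; exact pt_lt_pt.2 (Or.inl h)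
        · have : f y = .lt := by
            obtain h | rfl := h.lt_or_eq
            · exact hup x y h (by simp [hx])
            · exact hx
          rw [this, cut_eq_lt, pt_lt_pt]
          exact h.lt_or_eq.imp id fun h => ⟨h, by decide⟩
      push Not at hmax hmin
      let A : Gap X :=
        { lower := ⟨{x | f x = .gt}, fun a b hba ha => by
            obtain h | rfl := hba.lt_or_eq
            · exact hlow b a h (by rw [show f a = .gt from ha]; decide)
            · exact ha⟩
          noMax := fun a ha => by
            obtain ⟨b, hab, hb⟩ := hmax a ha
            exact ⟨b, by_contra fun h => hb (hcase b h), hab⟩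
          noMin := fun a ha => by
            obtain ⟨b, hab, hb⟩ := hmin a (hcase a ha)
            exact ⟨b, hb, hab⟩ }
      have hA : ∀ x, x ∈ A.lower ↔ f x = .gt := fun x => Iff.rfl
      refine ⟨gap A, funext fun x => ?_⟩
      by_cases hx : f x = .gt
      · rw [hx, cut_eq_gt, pt_lt_gap, hA, hx]
      · rw [hcase x hx, cut_eq_lt, gap_lt_pt, hA]; exact hx

theorem continuous_cut : Continuous (cut : BM X → X → Ordering) := by
  refine continuous_pi fun x => continuous_discrete_rng.2 fun o => ?_
  have h1 : (fun p : BM X => cut p x) ⁻¹' {Ordering.lt} = Set.Iio (pt x 0) := by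
    ext p; exact cut_eq_lt
  have h2 : (fun p : BM X => cut p x) ⁻¹' {Ordering.eq} = {pt x 0} := by
    ext p; exact cut_eq_eq
  have h3 : (fun p : BM X => cut p x) ⁻¹' {Ordering.gt} = Set.Ioi (pt x 0) := by
    ext p; exact cut_eq_gt
  cases o
  · rw [h1]; exact isOpen_Iio
  · rw [h2]; exact isOpen_singleton_pt x
  · rw [h3]; exact isOpen_Ioi

theorem isEmbedding_cut [DenselyOrdered X] : IsEmbedding (cut : BM X → X → Ordering) := by
  refine ⟨⟨le_antisymm continuous_cut.le_induced ?_⟩, cut_injective⟩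
  have hnhds : ∀ (q : BM X) (x : X) (s : Set (BM X)), (∀ r, cut r x = cut q x → r ∈ s) →
      s ∈ @nhds _ (TopologicalSpace.induced cut inferInstance) q := by
    intro q x s hs
    rw [nhds_induced]
    refine ⟨{f | f x = cut q x}, ?_, fun r hr => hs r hr⟩
    exact ((isOpen_discrete {cut q x}).preimage
      (continuous_apply x : Continuous fun f : X → Ordering => f x)).mem_nhds rfl
  refine (le_generateFrom ?_ : _ ≤ Preorder.topology (BM X))
  rintro s ⟨p, rfl | rfl⟩
  · refine (@isOpen_iff_mem_nhds _ (TopologicalSpace.induced cut inferInstance) (Set.Ioi p)).2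
      fun q (hq : p < q) => ?_
    obtain ⟨x, h1, h2⟩ := exists_pt_mem_Icc hq
    refine hnhds q x _ fun r hr => ?_
    obtain h2 | h2 := h2.lt_or_eq
    · exact h1.trans_lt (cut_eq_gt.1 (hr.trans (cut_eq_gt.2 h2)))
    · rw [cut_eq_eq.1 (hr.trans (cut_eq_eq.2 h2.symm)), h2]; exact hq
  · refine (@isOpen_iff_mem_nhds _ (TopologicalSpace.induced cut inferInstance) (Set.Iio p)).2
      fun q (hq : q < p) => ?_
    obtain ⟨x, h1, h2⟩ := exists_pt_mem_Icc hq
    refine hnhds q x _ fun r hr => ?_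
    obtain h1 | h1 := h1.lt_or_eq
    · exact (cut_eq_lt.1 (hr.trans (cut_eq_lt.2 h1))).trans_le h2
    · rw [cut_eq_eq.1 (hr.trans (cut_eq_eq.2 h1)), ← h1]; exact hq

instance : Finite Ordering := Finite.of_injective
  (fun o => (o == .lt, o == .eq) : Ordering → Bool × Bool) (by decide +revert)

theorem isClosed_range_cut [DenselyOrdered X] :
    IsClosed (Set.range (cut : BM X → X → Ordering)) := by
  rw [range_cut]
  simp only [Set.ofPred_forall, Set.ofPred_or]
  refine isClosed_iInter fun x => isClosed_iInter fun y => isClosed_iInter fun _ =>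
    IsClosed.union ?_ ?_ <;> exact isClosed_eq (continuous_apply _) continuous_const

/-- The uniformity of `b_m X`, given by the positions relative to finite sets of points of `X`. -/
instance [DenselyOrdered X] : UniformSpace (BM X) :=
  (UniformSpace.comap cut inferInstance).replaceTopology isEmbedding_cut.eq_induced

theorem isUniformInducing_cut [DenselyOrdered X] :
    IsUniformInducing (cut : BM X → X → Ordering) := ⟨rfl⟩

instance [DenselyOrdered X] : CompactSpace (BM X) :=
  (IsClosedEmbedding.mk isEmbedding_cut isClosed_range_cut).compactSpace

end BM

/-! ### Ultrahomogeneous chains -/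

theorem exists_lt_lt_of_infinite (X : Type*) [LinearOrder X] [Infinite X] :
    ∃ a b c : X, a < b ∧ b < c := by
  obtain ⟨s, hs⟩ := Infinite.exists_subset_card_eq X 3
  exact ⟨s.orderEmbOfFin hs 0, s.orderEmbOfFin hs 1, s.orderEmbOfFin hs 2,
    (s.orderEmbOfFin hs).strictMono (by decide), (s.orderEmbOfFin hs).strictMono (by decide)⟩

namespace IsUltrahomogeneous

/-- A strictly monotone map on a finite set extends to an automorphism. -/
theorem exists_extension (hX : IsUltrahomogeneous X) {F : Finset X} {f : X → X}
    (hf : StrictMonoOn f F) : ∃ g : X ≃o X, ∀ x ∈ F, g x = f x := by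
  obtain ⟨g, hg⟩ := hX F.card (F.orderEmbOfFin rfl) (f ∘ F.orderEmbOfFin rfl)
    (F.orderEmbOfFin rfl).strictMono fun i j h =>
      hf (F.orderEmbOfFin_mem rfl i) (F.orderEmbOfFin_mem rfl j)
        ((F.orderEmbOfFin rfl).strictMono h)
  refine ⟨g, fun x hx => ?_⟩
  rw [← Finset.mem_coe, ← F.range_orderEmbOfFin rfl] at hx
  obtain ⟨i, rfl⟩ := hx
  exact hg i

theorem exists_apply_eq (hX : IsUltrahomogeneous X) (a x : X) : ∃ g : X ≃o X, g a = x := by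
  obtain ⟨g, hg⟩ := hX.exists_extension (F := {a}) (f := fun _ => x) (by simp)
  exact ⟨g, hg a (by simp)⟩

theorem noMaxOrder (hX : IsUltrahomogeneous X) [Infinite X] : NoMaxOrder X := by
  obtain ⟨a, b, -, hab, -⟩ := exists_lt_lt_of_infinite X
  refine ⟨fun x => ?_⟩
  obtain ⟨g, rfl⟩ := hX.exists_apply_eq a x
  exact ⟨g b, g.strictMono hab⟩

theorem noMinOrder (hX : IsUltrahomogeneous X) [Infinite X] : NoMinOrder X := by
  obtain ⟨a, b, -, hab, -⟩ := exists_lt_lt_of_infinite X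
  refine ⟨fun x => ?_⟩
  obtain ⟨g, rfl⟩ := hX.exists_apply_eq b x
  exact ⟨g a, g.strictMono hab⟩

theorem denselyOrdered (hX : IsUltrahomogeneous X) [Infinite X] : DenselyOrdered X := by
  obtain ⟨a, b, c, hab, hbc⟩ := exists_lt_lt_of_infinite X
  refine ⟨fun x y hxy => ?_⟩
  obtain ⟨g, hg⟩ := hX 2 ![a, c] ![x, y]
    (by simpa [Fin.strictMono_iff_lt_succ] using hab.trans hbc)
    (by simpa [Fin.strictMono_iff_lt_succ] using hxy)
  have h0 : g a = x := hg 0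
  have h1 : g c = y := hg 1
  exact ⟨g b, h0 ▸ g.strictMono hab, h1 ▸ g.strictMono hbc⟩

end IsUltrahomogeneous

namespace BM

/-! ### Entourages of finite type -/

theorem mem_uniformity_comap_ordering {Y I : Type*} (e : Y → I → Ordering) {W : Set (Y × Y)} :
    W ∈ 𝓤[UniformSpace.comap e inferInstance] ↔
      ∃ F : Finset I, ∀ y y', (∀ i ∈ F, e y i = e y' i) → (y, y') ∈ W := by
  have h : 𝓤[UniformSpace.comap e inferInstance] =
      ⨅ i, 𝓟 {p : Y × Y | e p.1 i = e p.2 i} := by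
    change Filter.comap _ (𝓤 (I → Ordering)) = _
    rw [Pi.uniformity, Filter.comap_iInf]
    refine iInf_congr fun i => ?_
    have : 𝓤 Ordering = 𝓟 SetRel.id := rfl
    rw [this, Filter.comap_principal, Filter.comap_principal]
    rfl
  rw [h, (Filter.hasBasis_iInf_principal_finite _).mem_iff]
  constructor
  · rintro ⟨t, ht, htW⟩
    exact ⟨ht.toFinset, fun y y' hy => htW (Set.mem_iInter₂.2 fun i hi => hy i (by simpa using hi))⟩
  · rintro ⟨F, hF⟩
    exact ⟨F, F.finite_toSet, fun p hp => hF p.1 p.2 fun i hi => Set.mem_iInter₂.1 hp i hi⟩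

/-- The uniformity induced by a family of maps into `b_m X` is given by the positions of finitely
many values relative to finitely many points of `X`. -/
theorem mem_uniformity_comap_iff [DenselyOrdered X] {Y Z : Type*} (e : Y → Z → BM X)
    {W : Set (Y × Y)} :
    W ∈ 𝓤[UniformSpace.comap e inferInstance] ↔ ∃ (F : Finset Z) (τ : Finset X),
      ∀ y y', (∀ z ∈ F, ∀ t ∈ τ, cut (e y z) t = cut (e y' z) t) → (y, y') ∈ W := by
  classical
  have h : UniformSpace.comap e inferInstance =
      UniformSpace.comap (fun y (i : Z × X) => cut (e y i.1) i.2) inferInstance := by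
    have h1 := (isUniformInducing_cut (X := X)).comap_uniformSpace
    simp only [inferInstance]
    rw [Pi.uniformSpace_eq, Pi.uniformSpace_eq, UniformSpace.comap_iInf, UniformSpace.comap_iInf,
      iInf_prod]
    refine iInf_congr fun z => ?_
    rw [← h1, Pi.uniformSpace_eq, UniformSpace.comap_iInf, UniformSpace.comap_iInf,
      UniformSpace.comap_iInf]
    simp only [← UniformSpace.comap_comap]
    rfl
  rw [h, mem_uniformity_comap_ordering]
  constructor
  · rintro ⟨F, hF⟩
    refine ⟨F.image Prod.fst, F.image Prod.snd, fun y y' hy => hF y y' fun i hi => hy _ ?_ _ ?_⟩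
    · exact Finset.mem_image_of_mem _ hi
    · exact Finset.mem_image_of_mem _ hi
  · rintro ⟨F, τ, hF⟩
    exact ⟨F ×ˢ τ, fun y y' hy => hF y y' fun z hz t ht => hy (z, t) (by simp [hz, ht])⟩

/-- A density criterion for spaces of maps into `b_m X` with the topology of pointwise
convergence. -/
theorem denseRange_of_cut [DenselyOrdered X] {Y Z : Type*} {P : (Z → BM X) → Prop}
    (e : Y → {f : Z → BM X // P f})
    (h : ∀ f, P f → ∀ (F : Finset Z) (τ : Finset X),
      ∃ y, ∀ z ∈ F, ∀ t ∈ τ, cut ((e y).1 z) t = cut (f z) t) : DenseRange e := by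
  intro f
  rw [UniformSpace.mem_closure_iff_ball]
  intro V hV
  obtain ⟨F, τ, hF⟩ := (mem_uniformity_comap_iff (Subtype.val : {f // P f} → Z → BM X)).1 hV
  obtain ⟨y, hy⟩ := h f.1 f.2 F τ
  exact ⟨e y, hF _ _ fun z hz t ht => (hy z hz t ht).symm, ⟨y, rfl⟩⟩

/-! ### `b_m X` as the smallest linearly ordered compactification -/

/-- Some element of `X` has the position of `p` relative to a finite set `τ`, and it can be chosen
above a given finite set `lo` as far as this does not contradict the positions. -/
theorem exists_pt_cut_eq [DenselyOrdered X] [NoMinOrder X] [NoMaxOrder X] [Nonempty X] (p : BM X)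
    (τ lo : Finset X) (hlo : ∀ y ∈ lo, ∀ t ∈ τ, p ≤ pt t 0 → y < t) :
    ∃ m, (∀ y ∈ lo, y < m) ∧ ∀ t ∈ τ, cmp m t = cut p t := by
  classical
  by_cases hp : ∃ t ∈ τ, p = pt t 0
  · obtain ⟨t, ht, rfl⟩ := hp
    exact ⟨t, fun y hy => hlo y hy t ht le_rfl, fun s _ => (cut_pt_zero t s).symm⟩
  · push Not at hp
    obtain ⟨m, h1, h2⟩ := Order.exists_between_finsets (lo ∪ τ.filter fun t => pt t 0 < p)
      (τ.filter fun t => p < pt t 0) (by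
        intro x hx y hy
        rw [Finset.mem_filter] at hy
        rw [Finset.mem_union, Finset.mem_filter] at hx
        obtain hx | hx := hx
        · exact hlo x hx y hy.1 hy.2.le
        · obtain h | h := pt_lt_pt.1 (hx.2.trans hy.2)
          · exact h
          · exact absurd h.2 (lt_irrefl _))
    refine ⟨m, fun y hy => h1 y (Finset.mem_union_left _ hy), fun t ht => ?_⟩
    obtain h | h := lt_or_gt_of_ne (hp t ht)
    · rw [cut_eq_lt.2 h, cmp_eq_lt_iff]
      exact h2 t (Finset.mem_filter.2 ⟨ht, h⟩)
    · rw [cut_eq_gt.2 h, cmp_eq_gt_iff]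
      exact h1 t (Finset.mem_union_right _ (Finset.mem_filter.2 ⟨ht, h⟩))

theorem denseRange_pt [DenselyOrdered X] [NoMinOrder X] [NoMaxOrder X] [Nonempty X] :
    DenseRange (fun x : X => (pt x 0 : BM X)) := by
  intro p
  rw [UniformSpace.mem_closure_iff_ball]
  intro V hV
  obtain ⟨F, hF⟩ := (mem_uniformity_comap_ordering (cut : BM X → X → Ordering)).1 hV
  obtain ⟨x, -, hx⟩ := exists_pt_cut_eq p F ∅ (by simp)
  exact ⟨pt x 0, hF _ _ fun t ht => by rw [cut_pt_zero, hx t ht], ⟨x, rfl⟩⟩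

theorem strictMono_pt : StrictMono (fun x : X => (pt x 0 : BM X)) :=
  fun _ _ h => pt_lt_pt.2 (Or.inl h)

theorem isEmbedding_pt [TopologicalSpace X] [DiscreteTopology X] :
    IsEmbedding (fun x : X => (pt x 0 : BM X)) := by
  refine (IsOpenEmbedding.of_continuous_injective_isOpenMap continuous_of_discreteTopology
    strictMono_pt.injective fun s _ => ?_).isEmbedding
  rw [← Set.biUnion_of_singleton s, Set.image_iUnion₂]
  exact isOpen_biUnion fun x _ => by simpa using isOpen_singleton_pt x

theorem isMinimalLOCompactification [TopologicalSpace X] [DiscreteTopology X] [DenselyOrdered X]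
    [NoMinOrder X] [NoMaxOrder X] [Nonempty X] :
    IsMinimalLOCompactification (BM X) (fun x : X => BM.pt x 0) := by
  refine ⟨⟨inferInstance, inferInstance, strictMono_pt, isEmbedding_pt, denseRange_pt⟩, ?_⟩
  intro K' _ _ k' hk
  have := hk.orderTopology
  have hcut : ∀ p : K', (fun x => cmp p (k' x)) ∈ Set.range (cut : BM X → X → Ordering) := by
    intro p
    rw [range_cut]
    intro x y h
    have := hk.strictMono h
    simp only [cmp_eq_gt_iff, cmp_eq_lt_iff]
    by_contra! hc
    exact (hc.2.trans hc.1).not_gt this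
  -- the points of a dense discrete subspace are isolated in the whole space
  have hopen : ∀ x, IsOpen {k' x} := by
    intro x
    obtain ⟨O, hO, hOx⟩ := hk.isEmbedding.isOpen_iff.1 (isOpen_discrete {x})
    have hsub : O ⊆ {k' x} := by
      intro p hp
      by_contra hne
      obtain ⟨y, hy, hyne⟩ := hk.denseRange.exists_mem_open
        (hO.inter (isClosed_singleton (x := k' x)).isOpen_compl) ⟨p, hp, hne⟩
      have : y ∈ k' ⁻¹' O := hy
      rw [hOx] at this
      exact hyne (congrArg k' this)
    have : O = {k' x} := hsub.antisymm (by
      rintro _ rfl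
      exact (hOx ▸ rfl : x ∈ k' ⁻¹' O))
    exact this ▸ hO
  choose φ hφ using hcut
  refine ⟨φ, isEmbedding_cut.continuous_iff.2 ?_, fun x => cut_injective ?_⟩
  · have : cut ∘ φ = fun p x => cmp p (k' x) := funext hφ
    rw [this]
    refine continuous_pi fun x => continuous_discrete_rng.2 fun o => ?_
    have h1 : (fun p : K' => cmp p (k' x)) ⁻¹' {Ordering.lt} = Set.Iio (k' x) := by
      ext p; exact cmp_eq_lt_iff _ _
    have h2 : (fun p : K' => cmp p (k' x)) ⁻¹' {Ordering.eq} = {k' x} := by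
      ext p; exact cmp_eq_eq_iff _ _
    have h3 : (fun p : K' => cmp p (k' x)) ⁻¹' {Ordering.gt} = Set.Ioi (k' x) := by
      ext p; exact cmp_eq_gt_iff _ _
    cases o
    · rw [h1]; exact isOpen_Iio
    · rw [h2]; exact hopen x
    · rw [h3]; exact isOpen_Ioi
  · rw [hφ]
    funext y
    rw [cut_pt_zero, hk.strictMono.cmp_map_eq]

/-! ### The action on `b_m X` -/

theorem smul_pt (g : X ≃o X) (x : X) (j : SignType) : g • (pt x j : BM X) = pt (g x) j := rfl

theorem mem_map_lower {g : X ≃o X} {A : Gap X} {x : X} :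
    x ∈ (A.map g).lower ↔ g.symm x ∈ A.lower := by
  constructor
  · rintro ⟨a, ha, rfl⟩
    simpa using ha
  · exact fun h => ⟨_, h, g.apply_symm_apply x⟩

theorem smul_le_smul (g : X ≃o X) {p q : BM X} (h : p ≤ q) : g • p ≤ g • q := by
  cases p with
  | pt x i =>
    cases q with
    | pt y j => exact h.imp (fun h => g.strictMono h) fun h => ⟨congrArg g h.1, h.2⟩
    | gap B => exact mem_map_lower.2 (by rw [g.symm_apply_apply]; exact h)
  | gap A =>
    cases q with
    | pt y j => exact fun hy => h (by simpa using mem_map_lower.1 hy)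
    | gap B => exact fun x hx => mem_map_lower.2 (h (mem_map_lower.1 hx))

theorem monotone_smul (g : X ≃o X) : Monotone fun p : BM X => g • p :=
  fun _ _ => smul_le_smul g

/-- The action permutes the position functions, which makes it jointly continuous. -/
theorem cut_smul (g : X ≃o X) (p : BM X) (x : X) : cut (g • p) x = cut p (g.symm x) := by
  have h : StrictMono fun p : BM X => g • p :=
    (monotone_smul g).strictMono_of_injective (MulAction.injective g)
  have := h.cmp_map_eq p (pt (g.symm x) 0)
  simpa [smul_pt, cut] using this

theorem isOpen_setOf_symm_apply_eq (x y : X) : IsOpen {g : X ≃o X | g.symm x = y} := by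
  convert isOpen_setOf_apply_eq y x using 3 with g
  rw [OrderIso.symm_apply_eq, eq_comm]

instance [DenselyOrdered X] : ContinuousSMul (X ≃o X) (BM X) := by
  refine ⟨isEmbedding_cut.continuous_iff.2 (continuous_pi fun x =>
    continuous_iff_continuousAt.2 ?_)⟩
  rintro ⟨g, p⟩
  have h1 : ContinuousAt (fun q : (X ≃o X) × BM X => cut q.2 (g.symm x)) (g, p) :=
    ((continuous_apply _).comp (continuous_cut.comp continuous_snd)).continuousAt
  refine h1.congr ?_
  have h2 : ∀ᶠ q : (X ≃o X) × BM X in 𝓝 (g, p), q.1.symm x = g.symm x :=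
    continuous_fst.continuousAt.eventually_mem ((isOpen_setOf_symm_apply_eq x _).mem_nhds rfl)
  filter_upwards [h2] with q hq
  simp [cut_smul, hq]

end BM

/-! ### Prescribing the action of an automorphism on finitely many points of `b_m X` -/

/-- Two automorphisms which agree at the end points of an interval can be glued. -/
theorem exists_glue_interval (f g : X ≃o X) {a b : X} (ha : g a = f a)
    (hb : g b = f b) :
    ∃ o : X ≃o X, ∀ x, (x ∈ Set.Icc a b → o x = f x) ∧ (x ∉ Set.Icc a b → o x = g x) := by
  classical
  let k : X → X := fun x => if x ∈ Set.Icc a b then f x else g x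
  have hin : ∀ x, x ∈ Set.Icc a b → k x = f x := fun x hx => if_pos hx
  have hout : ∀ x, x ∉ Set.Icc a b → k x = g x := fun x hx => if_neg hx
  have hmono : StrictMono k := by
    intro x y hxy
    by_cases hx : x ∈ Set.Icc a b <;> by_cases hy : y ∈ Set.Icc a b
    · rw [hin x hx, hin y hy]; exact f.strictMono hxy
    · rw [hin x hx, hout y hy]
      have : b < y := lt_of_not_ge fun h => hy ⟨hx.1.trans hxy.le, h⟩
      exact (f.monotone hx.2).trans_lt (hb ▸ g.strictMono this)
    · rw [hout x hx, hin y hy]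
      have : x < a := lt_of_not_ge fun h => hx ⟨h, hxy.le.trans hy.2⟩
      exact (g.strictMono this).trans_le (ha ▸ f.monotone hy.1)
    · rw [hout x hx, hout y hy]; exact g.strictMono hxy
  have hsurj : Function.Surjective k := by
    intro y
    by_cases hy : f.symm y ∈ Set.Icc a b
    · exact ⟨f.symm y, by rw [hin _ hy, f.apply_symm_apply]⟩
    · refine ⟨g.symm y, ?_⟩
      rw [hout, g.apply_symm_apply]
      refine fun h => hy ⟨?_, ?_⟩
      · rw [OrderIso.le_symm_apply, ← ha, ← OrderIso.le_symm_apply]; exact h.1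
      · rw [OrderIso.symm_apply_le, ← hb, ← OrderIso.symm_apply_le]; exact h.2
  exact ⟨hmono.orderIsoOfSurjective k hsurj, fun x => ⟨hin x, hout x⟩⟩

theorem exists_glue_intervals {ι : Type*} (f g : X ≃o X) (s : Finset ι) (a b : ι → X)
    (ha : ∀ i ∈ s, g (a i) = f (a i))
    (hb : ∀ i ∈ s, g (b i) = f (b i)) :
    ∃ o : X ≃o X, ∀ x, ((∃ i ∈ s, x ∈ Set.Icc (a i) (b i)) → o x = f x) ∧
      ((¬ ∃ i ∈ s, x ∈ Set.Icc (a i) (b i)) → o x = g x) := by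
  classical
  induction s using Finset.induction_on with
  | empty => exact ⟨g, fun x => by simp⟩
  | insert i s hi ih =>
    simp only [Finset.forall_mem_insert] at ha hb
    obtain ⟨o, ho⟩ := ih ha.2 hb.2
    have hagree : ∀ x, g x = f x → o x = f x := fun x hx => by
      by_cases h : ∃ i ∈ s, x ∈ Set.Icc (a i) (b i)
      · exact (ho x).1 h
      · rw [(ho x).2 h, hx]
    obtain ⟨o', ho'⟩ := exists_glue_interval f o (hagree _ ha.1) (hagree _ hb.1)
    refine ⟨o', fun x => ?_⟩
    simp only [Finset.exists_mem_insert, not_or]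
    refine ⟨fun h => ?_, fun h => by rw [(ho' x).2 h.1, (ho x).2 h.2]⟩
    by_cases hx : x ∈ Set.Icc (a i) (b i)
    · exact (ho' x).1 hx
    · rw [(ho' x).2 hx, (ho x).1 (h.resolve_left hx)]

/-- A finite piece of an automorphism which preserves positions relative to a finite set `τ` can
be realized by an automorphism which fixes `τ`. -/
theorem IsUltrahomogeneous.exists_fixing (hX : IsUltrahomogeneous X) (f : X ≃o X)
    (S τ : Finset X) (h : ∀ x ∈ S, ∀ t ∈ τ, cmp (f x) t = cmp x t) :
    ∃ o : X ≃o X, (∀ t ∈ τ, o t = t) ∧ ∀ x ∈ S, o x = f x := by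
  classical
  have hfix : ∀ x ∈ S, x ∈ τ → f x = x := fun x hx ht => by
    have := h x hx x ht
    rwa [cmp_self_eq_eq, cmp_eq_eq_iff] at this
  obtain ⟨o, ho⟩ := hX.exists_extension (F := S ∪ τ) (f := fun x => if x ∈ τ then x else f x) (by
    intro x hx y hy hxy
    simp only [Finset.coe_union, Set.mem_union, Finset.mem_coe] at hx hy
    by_cases hx' : x ∈ τ <;> by_cases hy' : y ∈ τ
    · simpa [hx', hy'] using hxy
    · simp only [hx', hy', if_true, if_false]
      have := h y (hy.resolve_right hy') x hx'
      rwa [cmp_eq_gt_iff _ _ |>.2 hxy, cmp_eq_gt_iff] at this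
    · simp only [hx', hy', if_true, if_false]
      have := h x (hx.resolve_right hx') y hy'
      rwa [cmp_eq_lt_iff _ _ |>.2 hxy, cmp_eq_lt_iff] at this
    · simpa [hx', hy'] using hxy)
  refine ⟨o, fun t ht => ?_, fun x hx => ?_⟩
  · rw [ho t (Finset.mem_union_right _ ht), if_pos ht]
  · rw [ho x (Finset.mem_union_left _ hx)]
    by_cases hx' : x ∈ τ
    · rw [if_pos hx', hfix x hx hx']
    · rw [if_neg hx']

/-- A proper gap can be enclosed in an interval that avoids a given finite set. -/
theorem Gap.IsProper.exists_interval {A : Gap X} (hA : A.IsProper) (Z : Finset X) :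
    ∃ a ∈ A.lower, ∃ b ∉ A.lower, ∀ z ∈ Z, (z ∈ A.lower → z < a) ∧ (z ∉ A.lower → b < z) := by
  classical
  obtain ⟨⟨a₀, ha₀⟩, b₀, hb₀⟩ := hA
  have h1 : ∃ a ∈ A.lower, ∀ z ∈ Z, z ∈ A.lower → z < a := by
    obtain ⟨m, hm, hmax⟩ := Finset.exists_max_image (insert a₀ (Z.filter (· ∈ A.lower))) id
      (Finset.insert_nonempty _ _)
    have hmA : m ∈ A.lower := by
      obtain rfl | h := Finset.mem_insert.1 hm
      · exact ha₀
      · exact (Finset.mem_filter.1 h).2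
    obtain ⟨a, ha, hma⟩ := A.noMax m hmA
    exact ⟨a, ha, fun z hz hzA => (hmax z (Finset.mem_insert_of_mem
      (Finset.mem_filter.2 ⟨hz, hzA⟩))).trans_lt hma⟩
  have h2 : ∃ b ∉ A.lower, ∀ z ∈ Z, z ∉ A.lower → b < z := by
    obtain ⟨m, hm, hmin⟩ := Finset.exists_min_image (insert b₀ (Z.filter (· ∉ A.lower))) id
      (Finset.insert_nonempty _ _)
    have hmA : m ∉ A.lower := by
      obtain rfl | h := Finset.mem_insert.1 hm
      · exact hb₀
      · exact (Finset.mem_filter.1 h).2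
    obtain ⟨b, hb, hmb⟩ := A.noMin m hmA
    exact ⟨b, hb, fun z hz hzA => hmb.trans_le (hmin z (Finset.mem_insert_of_mem
      (Finset.mem_filter.2 ⟨hz, hzA⟩)))⟩
  obtain ⟨a, ha, ha'⟩ := h1
  obtain ⟨b, hb, hb'⟩ := h2
  exact ⟨a, ha, b, hb, fun z hz => ⟨ha' z hz, hb' z hz⟩⟩

namespace BM

theorem isBot_or_isTop_of_not_isProper {A : Gap X} (hA : ¬ A.IsProper) :
    IsBot (gap A) ∨ IsTop (gap A) := by
  by_cases h : ∃ a, a ∈ A.lower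
  · have hall : ∀ b, b ∈ A.lower := fun b => by_contra fun hb => hA ⟨h, b, hb⟩
    refine Or.inr fun p => ?_
    cases p with
    | pt x j => exact hall x
    | gap B => exact fun x _ => hall x
  · push Not at h
    refine Or.inl fun p => ?_
    cases p with
    | pt x j => exact h x
    | gap B => exact fun x hx => absurd hx (h x)

theorem smul_eq_of_isBot (g : X ≃o X) {p : BM X} (hp : IsBot p) : g • p = p :=
  le_antisymm (by simpa using smul_le_smul g (hp (g⁻¹ • p))) (hp _)

theorem smul_eq_of_isTop (g : X ≃o X) {p : BM X} (hp : IsTop p) : g • p = p :=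
  le_antisymm (hp _) (by simpa using smul_le_smul g (hp (g⁻¹ • p)))

theorem smul_eq_of_not_isProper (g : X ≃o X) {A : Gap X} (hA : ¬ A.IsProper) :
    g • gap A = gap A :=
  (isBot_or_isTop_of_not_isProper hA).elim (smul_eq_of_isBot g) (smul_eq_of_isTop g)

/-- The image of a gap is determined by the automorphism on an interval around the gap. -/
theorem smul_gap_le_of_eqOn {f o : X ≃o X} {A : Gap X} {a b : X} (ha : a ∈ A.lower)
    (hb : b ∉ A.lower) (h : ∀ x ∈ Set.Icc a b, o x = f x) : o • gap A ≤ f • gap A := by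
  have hab : a ≤ b := (lt_of_not_ge fun hba => hb (A.lower.lower hba ha)).le
  intro y hy
  rw [SetLike.mem_coe, mem_map_lower] at hy ⊢
  obtain ⟨x, rfl⟩ := o.surjective y
  rw [o.symm_apply_apply] at hy
  rcases le_total a x with hx | hx
  · rw [h x ⟨hx, (lt_of_not_ge fun hbx => hb (A.lower.lower hbx hy)).le⟩, f.symm_apply_apply]
    exact hy
  · have : o x ≤ f a := (o.monotone hx).trans_eq (h a ⟨le_rfl, hab⟩)
    exact A.lower.lower (f.symm_apply_le.2 this) ha

theorem smul_gap_eq_of_eqOn {f o : X ≃o X} {A : Gap X} {a b : X} (ha : a ∈ A.lower)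
    (hb : b ∉ A.lower) (h : ∀ x ∈ Set.Icc a b, o x = f x) : o • gap A = f • gap A :=
  le_antisymm (smul_gap_le_of_eqOn ha hb h) (smul_gap_le_of_eqOn ha hb fun x hx => (h x hx).symm)

theorem cut_gap_eq_gt {A : Gap X} {x : X} : cut (gap A) x = .gt ↔ x ∈ A.lower := by
  rw [cut_eq_gt, pt_lt_gap]

theorem cut_gap_eq_lt {A : Gap X} {x : X} : cut (gap A) x = .lt ↔ x ∉ A.lower := by
  rw [cut_eq_lt, gap_lt_pt]

theorem cmp_eq_cut_gap {A : Gap X} {x t : X} (h1 : t ∈ A.lower → t < x)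
    (h2 : t ∉ A.lower → x < t) : cmp x t = cut (gap A) t := by
  by_cases ht : t ∈ A.lower
  · rw [cut_gap_eq_gt.2 ht, cmp_eq_gt_iff]; exact h1 ht
  · rw [cut_gap_eq_lt.2 ht, cmp_eq_lt_iff]; exact h2 ht

theorem cmp_apply_left (f : X ≃o X) (x t : X) : cmp (f x) t = cmp x (f.symm t) := by
  conv_lhs => rw [← f.apply_symm_apply t]
  exact f.strictMono.cmp_map_eq _ _

end BM

open BM

/-- If `f` does not change the positions of finitely many points of `b_m X` relative to a finite
set `τ`, then some automorphism fixing `τ` acts on these points as `f` does. It is obtained by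
gluing `f`, on small intervals around the gaps in question, into an automorphism which is provided
by ultrahomogeneity. -/
theorem IsUltrahomogeneous.exists_fixing_smul_eq (hX : IsUltrahomogeneous X) [DenselyOrdered X]
    [NoMinOrder X] [NoMaxOrder X] [Nonempty X] (f : X ≃o X) (σ : Finset (BM X)) (τ : Finset X)
    (hpt : ∀ x j, pt x j ∈ σ → ∀ t ∈ τ, cmp (f x) t = cmp x t)
    (h : ∀ p ∈ σ, ∀ t ∈ τ, cut (f • p) t = cut p t) :
    ∃ o : X ≃o X, (∀ t ∈ τ, o t = t) ∧ ∀ p ∈ σ, o • p = f • p := by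
  classical
  -- `Good p a b`: in order to treat `p` it suffices to replace an automorphism by `f` on `[a, b]`
  let Good : BM X → X → X → Prop := fun p a b =>
    (∀ t ∈ τ, cmp (f a) t = cmp a t ∧ cmp (f b) t = cmp b t) ∧
    (∀ t ∈ τ, t ∈ Set.Icc a b → f t = t) ∧
    ∀ o : X ≃o X, (∀ x ∈ Set.Icc a b, o x = f x) → o • p = f • p
  have hgood : ∀ p, ∃ a b, p ∈ σ → Good p a b := by
    intro p
    by_cases hp : p ∈ σ
    swap
    · obtain ⟨x⟩ := ‹Nonempty X›
      exact ⟨x, x, fun h => absurd h hp⟩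
    cases p with
    | pt x j =>
      have hx := hpt x j hp
      refine ⟨x, x, fun _ => ⟨fun t ht => ⟨hx t ht, hx t ht⟩, fun t ht htx => ?_,
        fun o ho => ?_⟩⟩
      · obtain rfl : t = x := le_antisymm htx.2 htx.1
        have := hx t ht
        rwa [cmp_self_eq_eq, cmp_eq_eq_iff] at this
      · rw [smul_pt, smul_pt, ho x ⟨le_rfl, le_rfl⟩]
    | gap A =>
      have hmem : ∀ t ∈ τ, f.symm t ∈ A.lower ↔ t ∈ A.lower := fun t ht => by
        have := h _ hp t ht
        rw [← cut_gap_eq_gt, ← cut_gap_eq_gt, ← cut_smul, this]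
      by_cases hA : A.IsProper
      · obtain ⟨a, ha, b, hb, hz⟩ := hA.exists_interval (τ ∪ τ.image f.symm)
        have hab : a < b := lt_of_not_ge fun hba => hb (A.lower.lower hba ha)
        have h1 : ∀ z ∈ τ ∪ τ.image f.symm, cmp a z = cut (gap A) z := fun z hzZ =>
          cmp_eq_cut_gap (hz z hzZ).1 fun hzA => hab.trans ((hz z hzZ).2 hzA)
        have h2 : ∀ z ∈ τ ∪ τ.image f.symm, cmp b z = cut (gap A) z := fun z hzZ =>
          cmp_eq_cut_gap (fun hzA => ((hz z hzZ).1 hzA).trans hab) (hz z hzZ).2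
        have hτ : ∀ t ∈ τ, t ∈ τ ∪ τ.image f.symm := fun t => Finset.mem_union_left _
        have hτ' : ∀ t ∈ τ, f.symm t ∈ τ ∪ τ.image f.symm := fun t ht =>
          Finset.mem_union_right _ (Finset.mem_image_of_mem _ ht)
        have hcut : ∀ t ∈ τ, cut (gap A) (f.symm t) = cut (gap A) t := fun t ht => by
          rw [← cut_smul, h _ hp t ht]
        refine ⟨a, b, fun _ => ⟨fun t ht => ⟨?_, ?_⟩, fun t ht htab => ?_, fun o ho =>
          smul_gap_eq_of_eqOn ha hb ho⟩⟩
        · rw [cmp_apply_left, h1 _ (hτ' t ht), h1 _ (hτ t ht), hcut t ht]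
        · rw [cmp_apply_left, h2 _ (hτ' t ht), h2 _ (hτ t ht), hcut t ht]
        · by_cases htA : t ∈ A.lower
          · exact absurd htab.1 ((hz t (hτ t ht)).1 htA).not_ge
          · exact absurd htab.2 ((hz t (hτ t ht)).2 htA).not_ge
      · obtain ⟨m, hm, -⟩ := Order.exists_between_finsets (τ ∪ τ.image f.symm) ∅ (by simp)
        have h1 : ∀ t ∈ τ, cmp (f m) t = cmp m t := fun t ht => by
          rw [cmp_apply_left, (cmp_eq_gt_iff _ _).2 (hm _ (Finset.mem_union_left _ ht)),
            (cmp_eq_gt_iff _ _).2 (hm _ (Finset.mem_union_right _ (Finset.mem_image_of_mem _ ht)))]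
        refine ⟨m, m, fun _ => ⟨fun t ht => ⟨h1 t ht, h1 t ht⟩, fun t ht htm => ?_,
          fun o _ => ?_⟩⟩
        · exact absurd htm.1 (hm t (Finset.mem_union_left _ ht)).not_ge
        · rw [smul_eq_of_not_isProper o hA, smul_eq_of_not_isProper f hA]
  choose a b hab using hgood
  -- `g` fixes `τ` and agrees with `f` at the end points, so that `f` can be glued into `g`
  obtain ⟨g, hgτ, hg⟩ := hX.exists_fixing f (σ.image a ∪ σ.image b) τ (by
    intro x hx t ht
    obtain hx | hx := Finset.mem_union.1 hx
    · obtain ⟨p, hp, rfl⟩ := Finset.mem_image.1 hx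
      exact ((hab p hp).1 t ht).1
    · obtain ⟨p, hp, rfl⟩ := Finset.mem_image.1 hx
      exact ((hab p hp).1 t ht).2)
  obtain ⟨o, ho⟩ := exists_glue_intervals f g σ a b
    (fun p hp => hg _ (Finset.mem_union_left _ (Finset.mem_image_of_mem _ hp)))
    (fun p hp => hg _ (Finset.mem_union_right _ (Finset.mem_image_of_mem _ hp)))
  refine ⟨o, fun t ht => ?_, fun p hp => (hab p hp).2.2 o fun x hx => (ho x).1 ⟨p, hp, hx⟩⟩
  by_cases htU : ∃ p ∈ σ, t ∈ Set.Icc (a p) (b p)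
  · rw [(ho t).1 htU]
    obtain ⟨p, hp, htp⟩ := htU
    exact (hab p hp).2.1 t ht htp
  · rw [(ho t).2 htU, hgτ t ht]

/-! ### Approximation of monotone maps by automorphisms -/

/-- A monotone map into `b_m X` can be approximated on a finite set by a strictly
monotone map into `X`, which is constructed from left to right. -/
theorem exists_strictMonoOn_cut_eq [DenselyOrdered X] [NoMinOrder X] [NoMaxOrder X] [Nonempty X]
    {φ : X → BM X} (hφ : Monotone φ) (hinj : ∀ x y, φ x = φ y → x ≠ y → ¬ (φ x).MemX)
    (F τ : Finset X) :
    ∃ k : X → X, StrictMonoOn k F ∧ ∀ x ∈ F, ∀ t ∈ τ, cmp (k x) t = cut (φ x) t := by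
  classical
  induction F using Finset.induction_on_max with
  | empty => exact ⟨id, by simp [StrictMonoOn], by simp⟩
  | insert a F ha ih =>
    obtain ⟨k, hk, hkτ⟩ := ih
    obtain ⟨m, hm, hmτ⟩ := exists_pt_cut_eq (φ a) τ (F.image k) (by
      intro y hy t ht hat
      obtain ⟨x, hx, rfl⟩ := Finset.mem_image.1 hy
      have hle : φ x ≤ pt t 0 := (hφ (ha x hx).le).trans hat
      have hne : φ x ≠ pt t 0 := fun e =>
        hinj x a (le_antisymm (hφ (ha x hx).le) (hat.trans_eq e.symm)) (ha x hx).ne ⟨t, e⟩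
      have := hkτ x hx t ht
      rwa [cut_eq_lt.2 (lt_of_le_of_ne hle hne), cmp_eq_lt_iff] at this)
    have haF : a ∉ F := fun h => lt_irrefl _ (ha a h)
    have hk' : ∀ x ∈ F, Function.update k a m x = k x := fun x hx =>
      Function.update_of_ne (ne_of_mem_of_not_mem hx haF) _ _
    refine ⟨Function.update k a m, ?_, ?_⟩
    · intro x hx y hy hxy
      obtain rfl | hx' := Finset.mem_insert.1 hx
      · obtain rfl | hy' := Finset.mem_insert.1 hy
        · exact absurd hxy (lt_irrefl _)
        · exact absurd hxy (ha y hy').not_gt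
      · rw [hk' x hx']
        obtain rfl | hy' := Finset.mem_insert.1 hy
        · rw [Function.update_self]
          exact hm _ (Finset.mem_image_of_mem _ hx')
        · rw [hk' y hy']; exact hk hx' hy' hxy
    · intro x hx t ht
      obtain rfl | hx := Finset.mem_insert.1 hx
      · rw [Function.update_self]; exact hmτ t ht
      · rw [hk' x hx]; exact hkτ x hx t ht

/-- Every map in `RoelckeMaps X` is a pointwise limit of automorphisms. -/
theorem IsUltrahomogeneous.exists_cut_eq (hX : IsUltrahomogeneous X) [DenselyOrdered X]
    [NoMinOrder X] [NoMaxOrder X] [Nonempty X] {φ : X → BM X} (hφ : Monotone φ)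
    (hinj : ∀ x y, φ x = φ y → x ≠ y → ¬ (φ x).MemX) (F τ : Finset X) :
    ∃ g : X ≃o X, ∀ x ∈ F, ∀ t ∈ τ, cmp (g x) t = cut (φ x) t := by
  obtain ⟨k, hk, hkτ⟩ := exists_strictMonoOn_cut_eq hφ hinj F τ
  obtain ⟨g, hg⟩ := hX.exists_extension hk
  exact ⟨g, fun x hx t ht => by rw [hg x hx, hkτ x hx t ht]⟩

theorem BM.cut_pt (x t : X) (j : SignType) : cut (pt x j) t = (cmp x t).then (cmp j 0) := by
  rcases lt_trichotomy x t with h | rfl | h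
  · rw [(cmp_eq_lt_iff _ _).2 h, cut_eq_lt.2 (pt_lt_pt.2 (Or.inl h))]; rfl
  · rw [cmp_self_eq_eq]
    change _ = cmp j 0
    rcases lt_trichotomy j 0 with h | rfl | h
    · rw [(cmp_eq_lt_iff _ _).2 h, cut_eq_lt.2 (pt_lt_pt.2 (Or.inr ⟨rfl, h⟩))]
    · rw [cmp_self_eq_eq, cut_eq_eq]
    · rw [(cmp_eq_gt_iff _ _).2 h, cut_eq_gt.2 (pt_lt_pt.2 (Or.inr ⟨rfl, h⟩))]
  · rw [(cmp_eq_gt_iff _ _).2 h, cut_eq_gt.2 (pt_lt_pt.2 (Or.inl h))]; rfl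

theorem BM.not_memX_gap (A : Gap X) : ¬ (gap A).MemX := by rintro ⟨x, h⟩; cases h

theorem BM.cut_ne_eq_of_not_memX {p : BM X} (hp : ¬ p.MemX) (t : X) : cut p t ≠ .eq :=
  fun h => hp ⟨t, cut_eq_eq.1 h⟩

/-- Every map in `EllisMaps X` is a pointwise limit of automorphisms. Near each of
the finitely many gaps in question, the restriction of `f` to `X` is replaced by the value of `f`
at the gap; the result is a monotone map on `X`, which is approximated by an automorphism. -/
theorem IsUltrahomogeneous.exists_cut_smul_eq (hX : IsUltrahomogeneous X) [DenselyOrdered X]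
    [NoMinOrder X] [NoMaxOrder X] [Nonempty X] {f : BM X → BM X} (hf : IsEllisMap X f)
    (σ : Finset (BM X)) (τ : Finset X) :
    ∃ g : X ≃o X, ∀ p ∈ σ, ∀ t ∈ τ, cut (g • p) t = cut (f p) t := by
  classical
  -- a finite set that separates the points of `σ` and contains the points of `X` below them
  obtain ⟨Z, hZpt, hZsep⟩ : ∃ Z : Finset X, (∀ x j, pt x j ∈ σ → x ∈ Z) ∧
      ∀ p ∈ σ, ∀ q ∈ σ, (∀ z ∈ Z, cut p z = cut q z) → p = q := by
    have hsep : ∀ r : BM X × BM X, ∃ z, cut r.1 z = cut r.2 z → r.1 = r.2 := by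
      rintro ⟨p, q⟩
      by_contra! hc
      obtain ⟨x⟩ := ‹Nonempty X›
      exact (hc x).2 (cut_injective (funext fun z => (hc z).1))
    choose z hz using hsep
    obtain ⟨x₀⟩ := ‹Nonempty X›
    let π : BM X → X := fun p => match p with
      | pt x _ => x
      | gap _ => x₀
    refine ⟨σ.image π ∪ (σ ×ˢ σ).image z, fun x j hx =>
      Finset.mem_union_left _ (Finset.mem_image.2 ⟨_, hx, rfl⟩), fun p hp q hq h => ?_⟩
    exact hz (p, q) (h _ (Finset.mem_union_right _ (Finset.mem_image_of_mem _ (by simp [hp, hq]))))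
  -- `near x A`: no element of `Z` lies between `x` and the gap `A` of `σ`
  let near : X → Gap X → Prop := fun x A => gap A ∈ σ ∧ ∀ z ∈ Z, cmp x z = cut (gap A) z
  have near_unique : ∀ x A B, near x A → near x B → A = B := fun x A B hA hB => by
    have := hZsep _ hA.1 _ hB.1 fun z hz => by rw [← hA.2 z hz, hB.2 z hz]
    injection this
  let φ : X → BM X := fun x => if h : ∃ A, near x A then f (gap h.choose) else f (pt x 0)
  have hφ1 : ∀ x A, near x A → φ x = f (gap A) := fun x A h => by
    have h' : ∃ A, near x A := ⟨A, h⟩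
    simp only [φ, dif_pos h']
    rw [near_unique x _ _ h'.choose_spec h]
  have hφ2 : ∀ x, (¬ ∃ A, near x A) → φ x = f (pt x 0) := fun x h => by simp only [φ, dif_neg h]
  have near_lt : ∀ x A z, near x A → z ∈ Z → z ∈ A.lower → z < x := fun x A z h hz hzA => by
    rw [← cmp_eq_gt_iff, h.2 z hz, cut_gap_eq_gt]; exact hzA
  have lt_near : ∀ x A z, near x A → z ∈ Z → z ∉ A.lower → x < z := fun x A z h hz hzA => by
    rw [← cmp_eq_lt_iff, h.2 z hz, cut_gap_eq_lt]; exact hzA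
  have hmono : Monotone φ := by
    intro x y hxy
    by_cases hx : ∃ A, near x A <;> by_cases hy : ∃ A, near y A
    · obtain ⟨A, hA⟩ := hx
      obtain ⟨B, hB⟩ := hy
      rw [hφ1 x A hA, hφ1 y B hB]
      refine hf.monotone (le_of_not_gt fun hBA => hBA.ne ?_)
      refine hZsep _ hB.1 _ hA.1 fun z hz => ?_
      by_cases hzB : z ∈ B.lower
      · have hzA : z ∈ A.lower := hBA.le hzB
        rw [cut_gap_eq_gt.2 hzA, cut_gap_eq_gt.2 hzB]
      · have hzA : z ∉ A.lower := fun hzA =>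
          ((lt_near y B z hB hz hzB).trans (near_lt x A z hA hz hzA)).not_ge hxy
        rw [cut_gap_eq_lt.2 hzA, cut_gap_eq_lt.2 hzB]
    · obtain ⟨A, hA⟩ := hx
      rw [hφ1 x A hA, hφ2 y hy]
      refine hf.monotone (gap_le_pt.2 fun hyA => hy ⟨A, hA.1, fun z hz => ?_⟩)
      exact cmp_eq_cut_gap (fun hzA => (near_lt x A z hA hz hzA).trans_le hxy)
        fun hzA => lt_of_not_ge fun hzy => hzA (A.lower.lower hzy hyA)
    · obtain ⟨B, hB⟩ := hy
      rw [hφ2 x hx, hφ1 y B hB]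
      refine hf.monotone (pt_le_gap.2 (by_contra fun hxB => hx ⟨B, hB.1, fun z hz => ?_⟩))
      exact cmp_eq_cut_gap (fun hzB => lt_of_not_ge fun hxz => hxB (B.lower.lower hxz hzB))
        fun hzB => hxy.trans_lt (lt_near y B z hB hz hzB)
    · rw [hφ2 x hx, hφ2 y hy]
      exact hf.monotone (strictMono_pt.monotone hxy)
  have hinj : ∀ x y, φ x = φ y → x ≠ y → ¬ (φ x).MemX := by
    intro x y hxy hne
    have hgap : ∀ A, ¬ (f (gap A)).MemX := fun A => hf.not_mem_of_not_mem _ (not_memX_gap A)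
    by_cases hx : ∃ A, near x A
    · obtain ⟨A, hA⟩ := hx
      rw [hφ1 x A hA]; exact hgap A
    by_cases hy : ∃ A, near y A
    · obtain ⟨A, hA⟩ := hy
      rw [hxy, hφ1 y A hA]; exact hgap A
    rw [hφ2 x hx, hφ2 y hy] at hxy
    rw [hφ2 x hx]
    exact hf.not_mem_of_eq _ _ hxy (strictMono_pt.injective.ne hne)
  -- two values of `g` next to `p` control the position of `g • p`
  have hgood : ∀ p, ∃ a b, p ∈ σ → ∀ g : X ≃o X, (∀ t ∈ τ, cmp (g a) t = cut (φ a) t) →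
      (∀ t ∈ τ, cmp (g b) t = cut (φ b) t) → ∀ t ∈ τ, cut (g • p) t = cut (f p) t := by
    intro p
    obtain ⟨x₀⟩ := ‹Nonempty X›
    by_cases hp : p ∈ σ
    swap
    · exact ⟨x₀, x₀, fun h => absurd h hp⟩
    cases p with
    | pt x j =>
      refine ⟨x, x, fun _ g hg _ t ht => ?_⟩
      have hx : ¬ ∃ A, near x A := by
        rintro ⟨A, -, hA⟩
        have := hA x (hZpt x j hp)
        rw [cmp_self_eq_eq] at this
        exact cut_ne_eq_of_not_memX (not_memX_gap A) x this.symm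
      have hgt := hg t ht
      rw [hφ2 x hx] at hgt
      rw [smul_pt, cut_pt, hgt]
      obtain ⟨h1, h2, h3⟩ | ⟨y, hy⟩ := hf.triple x
      · have : f (pt x j) = f (pt x 0) := by
          cases j
          · rfl
          · exact h1
          · exact h2.symm
        rw [this]
        have := cut_ne_eq_of_not_memX h3 t
        revert this
        cases cut (f (pt x 0)) t <;> simp
      · rw [hy, hy, cut_pt_zero, cut_pt]
    | gap A =>
      by_cases hA : A.IsProper
      · obtain ⟨a, ha, b, hb, hz⟩ := hA.exists_interval Z
        have hab : a < b := lt_of_not_ge fun hba => hb (A.lower.lower hba ha)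
        have hna : near a A := ⟨hp, fun z hzZ =>
          cmp_eq_cut_gap (hz z hzZ).1 fun hzA => hab.trans ((hz z hzZ).2 hzA)⟩
        have hnb : near b A := ⟨hp, fun z hzZ =>
          cmp_eq_cut_gap (fun hzA => ((hz z hzZ).1 hzA).trans hab) (hz z hzZ).2⟩
        refine ⟨a, b, fun _ g hga hgb t ht => ?_⟩
        have h1 := hga t ht
        have h2 := hgb t ht
        rw [hφ1 a A hna] at h1
        rw [hφ1 b A hnb] at h2
        have := cut_ne_eq_of_not_memX (hf.not_mem_of_not_mem _ (not_memX_gap A)) t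
        rw [cut_smul]
        cases hc : cut (f (gap A)) t with
        | eq => exact absurd hc this
        | lt =>
          rw [hc, cmp_eq_lt_iff] at h2
          exact cut_gap_eq_lt.2 fun htA =>
            hb (A.lower.lower (g.le_symm_apply.2 h2.le) htA)
        | gt =>
          rw [hc, cmp_eq_gt_iff] at h1
          exact cut_gap_eq_gt.2 (A.lower.lower (g.symm_apply_le.2 h1.le) ha)
      · refine ⟨x₀, x₀, fun _ g _ _ t _ => ?_⟩
        obtain h | h := isBot_or_isTop_of_not_isProper hA
        · rw [smul_eq_of_isBot g h, hf.map_inf _ h]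
        · rw [smul_eq_of_isTop g h, hf.map_sup _ h]
  choose a b hab using hgood
  obtain ⟨g, hg⟩ := hX.exists_cut_eq hmono hinj (σ.image a ∪ σ.image b) τ
  exact ⟨g, fun p hp => hab p hp g
    (hg _ (Finset.mem_union_left _ (Finset.mem_image_of_mem _ hp)))
    (hg _ (Finset.mem_union_right _ (Finset.mem_image_of_mem _ hp)))⟩

open BM

/-! ### The uniformities on the automorphism group -/

/-- Points of `X` are isolated in `b_m X`, so that convergence of the values at points of `X` is
convergence in the permutation topology. -/
theorem isInducing_of_apply_eq_pt [DenselyOrdered X] {Z : Type*} {e : (X ≃o X) → Z → BM X}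
    (he : Continuous e) (hpt : ∀ x, ∃ z, ∀ g, e g z = pt (g x) 0) : IsInducing e := by
  refine ⟨le_antisymm he.le_induced (le_generateFrom ?_)⟩
  rintro _ ⟨x, y, rfl⟩
  obtain ⟨z, hz⟩ := hpt x
  refine ⟨{f | f z ∈ ({pt y 0} : Set (BM X))},
    (isOpen_singleton_pt y).preimage (continuous_apply z : Continuous fun f : Z → BM X => f z), ?_⟩
  ext g
  simp [hz]

theorem isInducing_smul [DenselyOrdered X] {Y : Type*} {ι : Y → BM X}
    (hι : ∀ x, ∃ y, ι y = pt x 0) :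
    IsInducing fun (g : X ≃o X) (y : Y) => g • ι y := by
  refine isInducing_of_apply_eq_pt (continuous_pi fun y => by fun_prop) fun x => ?_
  obtain ⟨y, hy⟩ := hι x
  exact ⟨y, fun g => by rw [hy, smul_pt]⟩

theorem setOf_fixing_mem_nhds_one (τ : Finset X) : {o : X ≃o X | ∀ t ∈ τ, o t = t} ∈ 𝓝 1 := by
  have : {o : X ≃o X | ∀ t ∈ τ, o t = t} = ⋂ t ∈ τ, {o | o t = t} := by ext; simp
  rw [this, Filter.biInter_finset_mem]
  exact fun t _ => (isOpen_setOf_apply_eq t t).mem_nhds rfl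

theorem exists_fixing_subset_of_mem_nhds_one [DenselyOrdered X] {O : Set (X ≃o X)}
    (hO : O ∈ 𝓝 1) : ∃ τ : Finset X, ∀ o : X ≃o X, (∀ t ∈ τ, o t = t) → o ∈ O := by
  have hi : IsInducing fun (g : X ≃o X) (x : X) => g • (pt x 0 : BM X) :=
    isInducing_smul fun x => ⟨x, rfl⟩
  rw [hi.nhds_eq_comap] at hO
  obtain ⟨S, hS, hSO⟩ := hO
  obtain ⟨V, hV, hVS⟩ := UniformSpace.mem_nhds_iff.1 hS
  obtain ⟨F, τ, hF⟩ := (mem_uniformity_comap_iff (id : (X → BM X) → X → BM X)).1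
    (by rwa [uniformSpace_comap_id])
  refine ⟨F, fun o ho => hSO (hVS (hF _ _ fun x hx t _ => ?_))⟩
  simp [smul_pt, ho x hx]

/-- The uniformity given by finite stabilizers is induced by pointwise convergence in `b_m X`. -/
theorem IsUltrahomogeneous.stabUnif_eq_comap (hX : IsUltrahomogeneous X) [DenselyOrdered X]
    [NoMinOrder X] [NoMaxOrder X] [Nonempty X] {Y : Type*} [MulAction (X ≃o X) Y] {ι : Y → BM X}
    (hι : Function.Injective ι) (hsmul : ∀ (g : X ≃o X) y, ι (g • y) = g • ι y)
    (hpt : ∀ x j, pt x j ∈ Set.range ι → pt x 0 ∈ Set.range ι) :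
    stabUnif (X ≃o X) Y =
      UniformSpace.comap (fun (g : X ≃o X) (y : Y) => g • ι y) inferInstance := by
  classical
  refine UniformSpace.ext (Filter.ext fun W => ?_)
  rw [mem_uniformity_comap_iff]
  refine ((stabFilter_hasBasis (X ≃o X) Y).mem_iff (t := W)).trans ?_
  constructor
  · rintro ⟨⟨O, σ⟩, hO, hW⟩
    obtain ⟨τ, hτ⟩ := exists_fixing_subset_of_mem_nhds_one hO
    -- the positions of `(x, 1)` and `(x, -1)` do not determine that of `x`, so `σ` is enlarged by
    -- the points `(x, 0)` which lie next to points `(x, j)` of `σ`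
    have hc : ∀ y, ∃ z, ∀ x j, ι y = pt x j → ι z = pt x 0 := by
      intro y
      by_cases hy : ∃ x j, ι y = pt x j
      · obtain ⟨x, j, hy⟩ := hy
        obtain ⟨z, hz⟩ := hpt x j ⟨y, hy⟩
        refine ⟨z, fun x' j' h => ?_⟩
        rw [hy] at h
        injection h with hx
        rw [hz, hx]
      · exact ⟨y, fun x j h => absurd ⟨x, j, h⟩ hy⟩
    choose c hc using hc
    refine ⟨σ ∪ σ.image c, τ, fun g h hgh => hW ?_⟩
    obtain ⟨o, hoτ, ho⟩ := hX.exists_fixing_smul_eq (h * g⁻¹)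
      (σ.image fun y => g • ι y) τ (by
        intro x j hx t ht
        obtain ⟨y, hy, hyx⟩ := Finset.mem_image.1 hx
        have hyx' : ι y = pt (g.symm x) j := by
          rw [← inv_smul_eq_iff.2 hyx.symm]; rfl
        have := hgh (c y) (Finset.mem_union_right _ (Finset.mem_image_of_mem _ hy)) t ht
        rw [hc y _ _ hyx', smul_pt, smul_pt, g.apply_symm_apply, cut_pt_zero, cut_pt_zero] at this
        exact this.symm) (by
        intro p hp t ht
        obtain ⟨y, hy, rfl⟩ := Finset.mem_image.1 hp
        rw [mul_smul, inv_smul_smul, hgh y (Finset.mem_union_left _ hy) t ht])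
    refine ⟨o, hτ o hoτ, g⁻¹ * o⁻¹ * h, ?_, by simp only; group⟩
    rw [mem_fixingSubgroup_iff]
    intro y hy
    have := ho (g • ι y) (Finset.mem_image_of_mem _ hy)
    rw [mul_smul, inv_smul_smul] at this
    refine hι ?_
    rw [hsmul, mul_smul, mul_smul, ← this, inv_smul_smul, inv_smul_smul]
  · rintro ⟨F, τ, hW⟩
    refine ⟨({o | ∀ t ∈ τ, o t = t}, F), setOf_fixing_mem_nhds_one τ, ?_⟩
    rintro ⟨g, h⟩ ⟨o, ho, s, hs, e⟩
    refine hW g h fun y hy t ht => ?_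
    have hsy : s • ι y = ι y := by
      rw [← hsmul]
      exact congrArg ι ((mem_fixingSubgroup_iff _).1 hs y hy)
    simp only at e
    rw [e, mul_smul, mul_smul, hsy, cut_smul o, (o.symm_apply_eq).2 (ho t ht).symm]

/-- The elements `g` and `o * g * s` are joined by `g * s`, which is close to `g` in the left and
to `o * g * s` in the right uniformity, so the infimum of the left and right
uniformities is given by the stabilizers of finite subsets of `X`. -/
theorem roelcke_eq_stabUnif [DenselyOrdered X] : roelcke (X ≃o X) = stabUnif (X ≃o X) X := by
  have hb := stabFilter_hasBasis (X ≃o X) X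
  have hst : ∀ (σ : Finset X) (s : X ≃o X), (∀ t ∈ σ, s t = t) →
      s ∈ fixingSubgroup (X ≃o X) (σ : Set X) := fun σ s h => (mem_fixingSubgroup_iff _).2 h
  refine le_antisymm (sup_le ?_ ?_) ?_
  · refine hb.ge_iff.2 fun i hi => ⟨_, setOf_fixing_mem_nhds_one i.2, ?_⟩
    rintro ⟨g, h⟩ hgh
    exact ⟨1, mem_of_mem_nhds hi, g⁻¹ * h, hst _ _ hgh, by simp⟩
  · refine hb.ge_iff.2 fun i hi => ⟨_, hi, ?_⟩
    rintro ⟨g, h⟩ hgh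
    exact ⟨h * g⁻¹, hgh, 1, one_mem _, by simp⟩
  · intro W hW
    obtain ⟨V, hV, hVW⟩ := @comp_mem_uniformity_sets _ (roelcke (X ≃o X)) W hW
    have hl : IsTopologicalGroup.leftUniformSpace (X ≃o X) ≤ roelcke (X ≃o X) := le_sup_left
    have hr : IsTopologicalGroup.rightUniformSpace (X ≃o X) ≤ roelcke (X ≃o X) := le_sup_right
    obtain ⟨O₁, hO₁, hV₁⟩ := hl hV
    obtain ⟨O₂, hO₂, hV₂⟩ := hr hV
    obtain ⟨τ, hτ⟩ := exists_fixing_subset_of_mem_nhds_one hO₁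
    refine hb.mem_iff.2 ⟨(O₂, τ), hO₂, ?_⟩
    rintro ⟨g, h⟩ ⟨o, ho, s, hs, e⟩
    simp only at e
    refine hVW ⟨g * s, hV₁ ?_, hV₂ ?_⟩
    · have : s ∈ O₁ := hτ s ((mem_fixingSubgroup_iff _).1 hs)
      simpa using this
    · simpa [e, mul_assoc] using ho

theorem stabUnif_BM_le : stabUnif (X ≃o X) (BM X) ≤ stabUnif (X ≃o X) X := by
  classical
  refine ((stabFilter_hasBasis (X ≃o X) (BM X)).le_basis_iff (stabFilter_hasBasis _ X)).2
    fun i hi => ⟨(i.1, i.2.image fun x => pt x 0), hi, ?_⟩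
  rintro p ⟨o, ho, s, hs, e⟩
  refine ⟨o, ho, s, (mem_fixingSubgroup_iff _).2 fun x hx => ?_, e⟩
  have := (mem_fixingSubgroup_iff _).1 hs (pt x 0) 
    (Finset.mem_coe.2 (Finset.mem_image_of_mem _ hx))
  rw [smul_pt] at this
  injection this

theorem IsUltrahomogeneous.stabUnif_eq_comap_X (hX : IsUltrahomogeneous X) [DenselyOrdered X]
    [NoMinOrder X] [NoMaxOrder X] [Nonempty X] : stabUnif (X ≃o X) X =
      UniformSpace.comap (fun (g : X ≃o X) (x : X) => g • (pt x 0 : BM X)) inferInstance :=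
  hX.stabUnif_eq_comap strictMono_pt.injective (fun _ _ => rfl) fun x _ _ => ⟨x, rfl⟩

theorem IsUltrahomogeneous.stabUnif_eq_comap_BM (hX : IsUltrahomogeneous X) [DenselyOrdered X]
    [NoMinOrder X] [NoMaxOrder X] [Nonempty X] : stabUnif (X ≃o X) (BM X) =
      UniformSpace.comap (fun (g : X ≃o X) (p : BM X) => g • p) inferInstance :=
  hX.stabUnif_eq_comap (ι := id) Function.injective_id (fun _ _ => rfl) fun _ _ _ => ⟨_, rfl⟩

theorem isTBEquiuniformity_smul [DenselyOrdered X] {Y : Type*} {ι : Y → BM X}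
    (hι : ∀ x, ∃ y, ι y = pt x 0) :
    IsTBEquiuniformity (X ≃o X)
      (UniformSpace.comap (fun (g : X ≃o X) (y : Y) => g • ι y) inferInstance) :=
  isTBEquiuniformity_comap (isInducing_smul hι) fun g h => funext fun y => mul_smul g h (ι y)

/-! ### The maximal equiuniformity on `X` -/

variable (X) in
/-- The uniformity of `X` as a subspace of `b_m X`. -/
abbrev chainUnif [DenselyOrdered X] : UniformSpace X :=
  UniformSpace.comap (fun x : X => (pt x 0 : BM X)) inferInstance

theorem isTBEquiuniformity_chainUnif [DenselyOrdered X] [TopologicalSpace X]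
    [DiscreteTopology X] : IsTBEquiuniformity (X ≃o X) (chainUnif X) :=
  isTBEquiuniformity_comap isEmbedding_pt.isInducing fun _ _ => rfl

/-- By boundedness, each entourage of an equiuniformity contains the orbit relation of the
stabilizer of a finite set. By ultrahomogeneity, the orbits consist of the points with equal
positions relative to this set. -/
theorem IsUltrahomogeneous.isMaximalEquiuniformity (hX : IsUltrahomogeneous X) [DenselyOrdered X]
    [TopologicalSpace X] [DiscreteTopology X] :
    IsMaximalEquiuniformity (X ≃o X) (chainUnif X) := by
  refine ⟨isTBEquiuniformity_chainUnif.1, fun V hV W hW => ?_⟩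
  obtain ⟨W', hW', hsymm, hWW'⟩ := @comp_symm_mem_uniformity_sets X V W hW
  obtain ⟨O, hO, d, ⟨D, hD, hDd⟩, hd⟩ := hV.bounded (Set.range fun x => {y | (x, y) ∈ W'})
    ⟨W', hW', fun x => ⟨_, ⟨x, rfl⟩, subset_rfl⟩⟩
  obtain ⟨τ, hτ⟩ := exists_fixing_subset_of_mem_nhds_one hO
  have h_cmp : UniformSpace.comap (fun x : X => (pt x 0 : BM X)) inferInstance =
      UniformSpace.comap (fun x t : X => cmp x t) inferInstance := by
    have : (fun x t : X => cmp x t) = cut ∘ fun x : X => pt x 0 :=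
      funext fun x => funext fun t => (cut_pt_zero x t).symm
    rw [this, UniformSpace.comap_comap, isUniformInducing_cut.comap_uniformSpace]
  rw [chainUnif, h_cmp, mem_uniformity_comap_ordering]
  refine ⟨τ, fun x y hxy => ?_⟩
  obtain ⟨f, hf⟩ := hX.exists_apply_eq x y
  obtain ⟨o, hoτ, ho⟩ := hX.exists_fixing f {x} τ (by
    intro z hz t ht
    obtain rfl := Finset.mem_singleton.1 hz
    rw [hf, hxy t ht])
  obtain ⟨E, hE, hDE⟩ := hDd x
  obtain ⟨_, ⟨z, rfl⟩, hz⟩ := hd E hE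
  have hxE : x ∈ E := hDE (@refl_mem_uniformity X V x D hD)
  have hx1 : (z, x) ∈ W' := by
    have := hz 1 (mem_of_mem_nhds hO) x hxE
    rwa [one_smul] at this
  have hy1 : (z, y) ∈ W' := by
    have := hz o (hτ o hoτ) x hxE
    rwa [RelIso.smul_def, ho x (by simp), hf] at this
  exact hWW' ⟨z, hsymm.symm _ _ hx1, hy1⟩

theorem exists_uniformEquiv_chainUnif [DenselyOrdered X] [NoMinOrder X] [NoMaxOrder X]
    [Nonempty X] : ∃ Φ : UCompl (chainUnif X) ≃ᵤ BM X, ∀ x, Φ (UCompl.coe _ x) = pt x 0 :=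
  UCompl.exists_uniformEquiv rfl denseRange_pt

theorem ellisUnif_chainUnif [DenselyOrdered X] : ellisUnif (X ≃o X) (chainUnif X) =
    UniformSpace.comap (fun (g : X ≃o X) (x : X) => g • (pt x 0 : BM X)) inferInstance := by
  simp only [inferInstance]
  rw [ellisUnif, Pi.uniformSpace_eq, Pi.uniformSpace_eq, UniformSpace.comap_iInf,
    UniformSpace.comap_iInf]
  simp only [← UniformSpace.comap_comap]
  rfl

open BM

/-! ### The Roelcke compactification -/

theorem isClosed_setOf_forall {Y ι : Type*} [TopologicalSpace Y] {P : ι → Y → Prop}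
    (h : ∀ i, IsClosed {y | P i y}) : IsClosed {y | ∀ i, P i y} :=
  Set.ofPred_forall P ▸ isClosed_iInter h

theorem isClosed_imp_left {Y : Type*} [TopologicalSpace Y] {p : Prop} {Q : Y → Prop}
    (h : IsClosed {y | Q y}) : IsClosed {y | p → Q y} := by
  by_cases hp : p <;> simp [hp, h]

namespace BM

theorem isOpen_setOf_memX : IsOpen {p : BM X | p.MemX} := by
  have : {p : BM X | p.MemX} = ⋃ x, {pt x 0} := by ext; simp [MemX, eq_comm]
  rw [this]
  exact isOpen_iUnion isOpen_singleton_pt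

theorem isClosed_not_memX_of_eq {Z : Type*} (y z : Z) :
    IsClosed {f : Z → BM X | f y = f z → y ≠ z → ¬ (f y).MemX} := by
  by_cases hyz : y = z
  · simp [hyz]
  have : {f : Z → BM X | f y = f z → y ≠ z → ¬ (f y).MemX}ᶜ =
      ⋃ x, (fun f : Z → BM X => (f y, f z)) ⁻¹' ({pt x 0} ×ˢ {pt x 0}) := by
    ext f
    simp only [Set.mem_compl_iff, Set.mem_ofPred_eq, hyz, not_false_eq_true, forall_const,
      Classical.not_imp, not_not, MemX, ne_eq, Set.mem_iUnion, Set.mem_preimage, Set.mem_prod,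
      Set.mem_singleton_iff]
    constructor
    · rintro ⟨h, x, hx⟩
      exact ⟨x, hx, h ▸ hx⟩
    · rintro ⟨x, hx, hx'⟩
      exact ⟨hx.trans hx'.symm, x, hx⟩
  rw [← isOpen_compl_iff, this]
  exact isOpen_iUnion fun x => ((isOpen_singleton_pt x).prod (isOpen_singleton_pt x)).preimage
    ((continuous_apply y).prodMk (continuous_apply z))

theorem memX_smul_iff (g : X ≃o X) {p : BM X} : (g • p).MemX ↔ p.MemX := by
  constructor
  · rintro ⟨x, hx⟩
    exact ⟨g.symm x, (inv_smul_eq_iff.2 hx.symm).symm⟩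
  · rintro ⟨x, rfl⟩
    exact ⟨g x, rfl⟩

end BM

instance [DenselyOrdered X] : CompactSpace (RoelckeMaps X) := by
  refine (isCompact_iff_compactSpace (s := {f : X → BM X |
    Monotone f ∧ ∀ x y, f x = f y → x ≠ y → ¬ (f x).MemX})).1 (IsClosed.isCompact ?_)
  exact isClosed_monotone.and (isClosed_setOf_forall fun x =>
    isClosed_setOf_forall fun y => isClosed_not_memX_of_eq x y)

/-- Automorphisms act on maps `X → b_m X` by composition on the left. -/
instance : MulAction (X ≃o X) (RoelckeMaps X) where
  smul g f := ⟨fun x => g • f.1 x, fun _ _ h => smul_le_smul g (f.2.1 h), fun x y h hne => by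
    rw [memX_smul_iff]
    exact f.2.2 x y (MulAction.injective g h) hne⟩
  one_smul f := Subtype.ext (funext fun x => one_smul _ (f.1 x))
  mul_smul g h f := Subtype.ext (funext fun x => mul_smul g h (f.1 x))

instance [DenselyOrdered X] : ContinuousConstSMul (X ≃o X) (RoelckeMaps X) := by
  refine ⟨fun g => Continuous.subtype_mk (continuous_pi fun x => ?_) _⟩
  exact ((continuous_apply x).comp continuous_subtype_val).const_smul g

/-- The inclusion of `X` in `b_m X`. -/
def RoelckeMaps.incl : RoelckeMaps X :=
  ⟨fun x => pt x 0, strictMono_pt.monotone, fun _ _ h hne => absurd (strictMono_pt.injective h) hne⟩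

/-- Constant maps with values outside `X` belong to the Roelcke compactification. -/
def RoelckeMaps.const (p : BM X) (hp : ¬ p.MemX) : RoelckeMaps X :=
  ⟨fun _ => p, monotone_const, fun _ _ _ _ => hp⟩

theorem IsUltrahomogeneous.denseRange_smul_incl (hX : IsUltrahomogeneous X) [DenselyOrdered X]
    [NoMinOrder X] [NoMaxOrder X] [Nonempty X] :
    DenseRange fun g : X ≃o X => g • (RoelckeMaps.incl : RoelckeMaps X) := by
  refine denseRange_of_cut _ fun f hf F τ => ?_
  obtain ⟨g, hg⟩ := hX.exists_cut_eq hf.1 hf.2 F τ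
  exact ⟨g, fun x hx t ht => (cut_pt_zero (g x) t).trans (hg x hx t ht)⟩

theorem IsUltrahomogeneous.exists_uniformEquiv_roelcke (hX : IsUltrahomogeneous X)
    [DenselyOrdered X] [NoMinOrder X] [NoMaxOrder X] [Nonempty X] :
    ∃ Ψ : UCompl (roelcke (X ≃o X)) ≃ᵤ RoelckeMaps X,
      ∀ g, Ψ (UCompl.coe _ g) = g • RoelckeMaps.incl := by
  refine UCompl.exists_uniformEquiv ?_ hX.denseRange_smul_incl
  rw [roelcke_eq_stabUnif, hX.stabUnif_eq_comap_X]
  exact UniformSpace.comap_comap (f := fun g : X ≃o X => g • (RoelckeMaps.incl : RoelckeMaps X))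
    (g := Subtype.val)

theorem IsUltrahomogeneous.isTBEquiuniformity_roelcke (hX : IsUltrahomogeneous X)
    [DenselyOrdered X] [NoMinOrder X] [NoMaxOrder X] [Nonempty X] :
    IsTBEquiuniformity (X ≃o X) (roelcke (X ≃o X)) := by
  rw [roelcke_eq_stabUnif, hX.stabUnif_eq_comap_X]
  exact isTBEquiuniformity_smul fun x => ⟨x, rfl⟩

/-- The values of the maps in the Roelcke compactification exhaust `b_m X`, hence pointwise
convergence on the Roelcke compactification is pointwise convergence on `b_m X`. -/
theorem IsUltrahomogeneous.ellisUnifExt_roelcke (hX : IsUltrahomogeneous X) [DenselyOrdered X]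
    [NoMinOrder X] [NoMaxOrder X] [Nonempty X] :
    ellisUnifExt (X ≃o X) (roelcke (X ≃o X)) =
      UniformSpace.comap (fun (g : X ≃o X) (p : BM X) => g • p) inferInstance := by
  obtain ⟨Ψ, hΨ⟩ := hX.exists_uniformEquiv_roelcke
  rw [ellisUnifExt_eq_comap Ψ hΨ hX.isTBEquiuniformity_roelcke.1.saturated
    fun g h => mul_smul g h RoelckeMaps.incl]
  simp only [inferInstance]
  have h1 : UniformSpace.comap (fun (g : X ≃o X) (f : RoelckeMaps X) => g • f)
      (Pi.uniformSpace fun _ => RoelckeMaps X) = ⨅ (f : RoelckeMaps X) (x : X),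
        UniformSpace.comap (fun g : X ≃o X => g • f.1 x) inferInstance := by
    rw [Pi.uniformSpace_eq, UniformSpace.comap_iInf]
    refine iInf_congr fun f => ?_
    change UniformSpace.comap _ (UniformSpace.comap _ (UniformSpace.comap Subtype.val
      (Pi.uniformSpace fun _ => BM X))) = _
    rw [Pi.uniformSpace_eq, UniformSpace.comap_iInf, UniformSpace.comap_iInf,
      UniformSpace.comap_iInf]
    simp only [← UniformSpace.comap_comap]
    rfl
  have h2 : UniformSpace.comap (fun (g : X ≃o X) (p : BM X) => g • p)
      (Pi.uniformSpace fun _ => BM X) = ⨅ p : BM X,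
        UniformSpace.comap (fun g : X ≃o X => g • p) inferInstance := by
    rw [Pi.uniformSpace_eq, UniformSpace.comap_iInf]
    simp only [← UniformSpace.comap_comap]
    rfl
  rw [h1, h2]
  refine le_antisymm (le_iInf fun p => ?_) (le_iInf₂ fun f x => iInf_le _ (f.1 x))
  by_cases hp : p.MemX
  · obtain ⟨x, rfl⟩ := hp
    exact iInf₂_le_of_le (RoelckeMaps.incl : RoelckeMaps X) x le_rfl
  · obtain ⟨x⟩ := ‹Nonempty X›
    exact iInf₂_le_of_le (RoelckeMaps.const p hp) x le_rfl

/-! ### The Ellis compactification -/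

namespace BM

/-- The map of `b_m X` which moves each point `(x, 0)` to `(x, j)` and fixes all other points. -/
def shift (j : SignType) : BM X → BM X
  | pt x i => if i = 0 then pt x j else pt x i
  | gap A => gap A

theorem shift_pt_zero (j : SignType) (x : X) : shift j (pt x 0) = pt x j := by simp [shift]

theorem shift_of_not_memX (j : SignType) {p : BM X} (hp : ¬ p.MemX) : shift j p = p := by
  cases p with
  | pt x i =>
    have : i ≠ 0 := fun h => hp ⟨x, by rw [h]⟩
    simp [shift, this]
  | gap A => rfl

theorem cut_shift (j : SignType) (p : BM X) (t : X) :
    cut (shift j p) t = (cut p t).then (cmp j 0) := by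
  by_cases hp : p.MemX
  · obtain ⟨x, rfl⟩ := hp
    rw [shift_pt_zero, cut_pt, cut_pt_zero]
  · rw [shift_of_not_memX j hp]
    have := cut_ne_eq_of_not_memX hp t
    revert this
    cases cut p t <;> simp

/-- The position of `shift j p` depends only on that of `p`. -/
theorem continuous_shift [DenselyOrdered X] (j : SignType) :
    Continuous (shift j : BM X → BM X) := by
  refine isEmbedding_cut.continuous_iff.2 (continuous_pi fun t => ?_)
  have : (fun p : BM X => (cut ∘ shift j) p t) = (fun o => o.then (cmp j 0)) ∘ fun p => cut p t :=
    funext fun p => cut_shift j p t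
  rw [this]
  exact continuous_of_discreteTopology.comp ((continuous_apply t).comp continuous_cut)

end BM

/-- The condition on the triples over points of `X` says that `f` commutes with the maps `shift j`
on `X`. As these maps are continuous, the condition is closed. -/
theorem isEllisMap_iff_shift {f : BM X → BM X} : IsEllisMap X f ↔
    Monotone f ∧ (∀ p, ¬ p.MemX → ¬ (f p).MemX) ∧ (∀ p q, f p = f q → p ≠ q → ¬ (f p).MemX) ∧
      (∀ x j, f (pt x j) = shift j (f (pt x 0))) ∧ (∀ p, IsBot p → f p = p) ∧
      ∀ p, IsTop p → f p = p := by
  constructor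
  · rintro ⟨h1, h2, h3, h4, h5, h6⟩
    refine ⟨h1, h2, h3, fun x j => ?_, h5, h6⟩
    obtain ⟨e1, e2, hn⟩ | ⟨y, hy⟩ := h4 x
    · rw [shift_of_not_memX j hn]
      cases j
      · rfl
      · exact e1
      · exact e2.symm
    · rw [hy, hy, shift_pt_zero]
  · rintro ⟨h1, h2, h3, h4, h5, h6⟩
    refine ⟨h1, h2, h3, fun x => ?_, h5, h6⟩
    by_cases hx : (f (pt x 0)).MemX
    · obtain ⟨y, hy⟩ := hx
      exact Or.inr ⟨y, fun j => by rw [h4, hy, shift_pt_zero]⟩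
    · refine Or.inl ⟨?_, ?_, hx⟩
      · rw [h4, shift_of_not_memX _ hx]
      · rw [h4 x 1, shift_of_not_memX _ hx]

instance [DenselyOrdered X] : CompactSpace (EllisMaps X) := by
  refine (isCompact_iff_compactSpace (s := {f : BM X → BM X | IsEllisMap X f})).1
    (IsClosed.isCompact ?_)
  simp only [isEllisMap_iff_shift]
  have heval : ∀ p : BM X, Continuous fun f : BM X → BM X => f p := continuous_apply
  refine isClosed_monotone.and (IsClosed.and ?_ (IsClosed.and ?_
    (IsClosed.and ?_ (IsClosed.and ?_ ?_))))
  · exact isClosed_setOf_forall fun p => isClosed_imp_left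
      (isOpen_setOf_memX.isClosed_compl.preimage (heval p))
  · exact isClosed_setOf_forall fun p => isClosed_setOf_forall fun q => isClosed_not_memX_of_eq p q
  · exact isClosed_setOf_forall fun x => isClosed_setOf_forall fun j =>
      isClosed_eq (heval _) ((continuous_shift j).comp (heval _))
  · exact isClosed_setOf_forall fun p => isClosed_imp_left (isClosed_eq (heval p) continuous_const)
  · exact isClosed_setOf_forall fun p => isClosed_imp_left (isClosed_eq (heval p) continuous_const)

theorem IsEllisMap.comp {f h : BM X → BM X} (hf : IsEllisMap X f) (hh : IsEllisMap X h) :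
    IsEllisMap X (f ∘ h) where
  monotone := hf.monotone.comp hh.monotone
  not_mem_of_not_mem p hp := hf.not_mem_of_not_mem _ (hh.not_mem_of_not_mem p hp)
  not_mem_of_eq p q e hne := by
    by_cases hpq : h p = h q
    · exact hf.not_mem_of_not_mem _ (hh.not_mem_of_eq p q hpq hne)
    · exact hf.not_mem_of_eq _ _ e hpq
  triple x := by
    obtain ⟨e1, e2, hn⟩ | ⟨y, hy⟩ := hh.triple x
    · exact Or.inl ⟨congrArg f e1, congrArg f e2, hf.not_mem_of_not_mem _ hn⟩
    · simp only [Function.comp_apply, hy]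
      exact hf.triple y
  map_inf p hp := by rw [Function.comp_apply, hh.map_inf p hp, hf.map_inf p hp]
  map_sup p hp := by rw [Function.comp_apply, hh.map_sup p hp, hf.map_sup p hp]

theorem isEllisMap_smul (g : X ≃o X) : IsEllisMap X fun p => g • p where
  monotone := monotone_smul g
  not_mem_of_not_mem p hp := by rwa [memX_smul_iff]
  not_mem_of_eq p q e hne := absurd (MulAction.injective g e) hne
  triple x := Or.inr ⟨g x, fun j => rfl⟩
  map_inf p hp := smul_eq_of_isBot g hp
  map_sup p hp := smul_eq_of_isTop g hp

/-- The semigroup structure of `EllisMaps X` is composition of maps. -/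
instance : Semigroup (EllisMaps X) where
  mul f h := ⟨f.1 ∘ h.1, f.2.comp h.2⟩
  mul_assoc _ _ _ := rfl

/-- An automorphism as a self-map of `b_m X`. -/
def EllisMaps.ofAut (g : X ≃o X) : EllisMaps X := ⟨fun p => g • p, isEllisMap_smul g⟩

theorem IsUltrahomogeneous.denseRange_ofAut (hX : IsUltrahomogeneous X) [DenselyOrdered X]
    [NoMinOrder X] [NoMaxOrder X] [Nonempty X] :
    DenseRange (EllisMaps.ofAut : (X ≃o X) → EllisMaps X) :=
  denseRange_of_cut _ fun _ hf F τ => hX.exists_cut_smul_eq hf F τ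

theorem isEmbedding_ofAut [DenselyOrdered X] :
    IsEmbedding (EllisMaps.ofAut : (X ≃o X) → EllisMaps X) := by
  refine ⟨IsInducing.of_comp_iff IsInducing.subtypeVal |>.1
    (isInducing_smul (ι := (id : BM X → BM X)) fun x => ⟨_, rfl⟩), fun g h e => ?_⟩
  refine OrderIso.ext (funext fun x => ?_)
  have := congrFun (congrArg Subtype.val e) (pt x 0)
  change pt (g x) 0 = pt (h x) 0 at this
  injection this

theorem IsUltrahomogeneous.isEllisCompactification (hX : IsUltrahomogeneous X) [DenselyOrdered X]
    [NoMinOrder X] [NoMaxOrder X] [Nonempty X] :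
    IsEllisCompactification (X ≃o X) (EllisMaps X) EllisMaps.ofAut where
  compact := inferInstance
  t2 := inferInstance
  right_topological h := continuous_induced_rng.2 (continuous_pi fun p =>
    ((continuous_apply (h.1 p)).comp continuous_subtype_val :
      Continuous fun f : EllisMaps X => f.1 (h.1 p)))
  map_mul g h := Subtype.ext (funext fun p => mul_smul g h p)
  isEmbedding := isEmbedding_ofAut
  denseRange := hX.denseRange_ofAut
  continuousOn_mul := by
    have hc : Continuous fun p : (X ≃o X) × EllisMaps X => EllisMaps.ofAut p.1 * p.2 :=
      continuous_induced_rng.2 (continuous_pi fun q => (continuous_fst.smul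
        ((continuous_apply q).comp (continuous_subtype_val.comp continuous_snd)) :
          Continuous fun p : (X ≃o X) × EllisMaps X => p.1 • p.2.1 q))
    have hi : IsInducing fun p : (X ≃o X) × EllisMaps X => (EllisMaps.ofAut p.1, p.2) :=
      isEmbedding_ofAut.isInducing.prodMap IsInducing.id
    have hr : Set.range (fun p : (X ≃o X) × EllisMaps X => (EllisMaps.ofAut p.1, p.2)) =
        Set.range (EllisMaps.ofAut : (X ≃o X) → EllisMaps X) ×ˢ Set.univ := by
      ext ⟨a, b⟩
      simp [Prod.ext_iff]
    rintro ⟨a, b⟩ hab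
    rw [← hr] at hab ⊢
    obtain ⟨p, hp⟩ := hab
    rw [← hp, ContinuousWithinAt, ← hi.map_nhds_eq, Filter.tendsto_map'_iff]
    exact hc.tendsto p

theorem IsUltrahomogeneous.exists_uniformEquiv_stabUnif (hX : IsUltrahomogeneous X)
    [DenselyOrdered X] [NoMinOrder X] [NoMaxOrder X] [Nonempty X] :
    ∃ Φ : UCompl (stabUnif (X ≃o X) (BM X)) ≃ᵤ EllisMaps X,
      ∀ g, Φ (UCompl.coe _ g) = EllisMaps.ofAut g := by
  refine UCompl.exists_uniformEquiv ?_ hX.denseRange_ofAut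
  rw [hX.stabUnif_eq_comap_BM]
  exact UniformSpace.comap_comap (f := (EllisMaps.ofAut : (X ≃o X) → EllisMaps X))
    (g := Subtype.val)

theorem IsUltrahomogeneous.isEllisEquiuniformity_stabUnif (hX : IsUltrahomogeneous X)
    [DenselyOrdered X] [NoMinOrder X] [NoMaxOrder X] [Nonempty X] :
    IsEllisEquiuniformity (X ≃o X) (stabUnif (X ≃o X) (BM X)) := by
  refine ⟨?_, ?_⟩
  · rw [hX.stabUnif_eq_comap_BM]
    exact isTBEquiuniformity_smul (ι := (id : BM X → BM X)) fun x => ⟨_, rfl⟩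
  · obtain ⟨Φ, hΦ⟩ := hX.exists_uniformEquiv_stabUnif
    exact hX.isEllisCompactification.exists_of_homeomorph Φ.toHomeomorph hΦ

/-! ### Continuous chains -/

/-- In a continuous chain all points of `b_m X` other than the two end points lie over points of
`X`, and the position of `g (x, j)` is determined by the position of `g x`. -/
theorem IsUltrahomogeneous.stabUnif_eq_of_isContinuousChain (hX : IsUltrahomogeneous X)
    [DenselyOrdered X] [NoMinOrder X] [NoMaxOrder X] [Nonempty X] (hc : IsContinuousChain X) :
    stabUnif (X ≃o X) X = stabUnif (X ≃o X) (BM X) := by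
  classical
  refine le_antisymm ?_ stabUnif_BM_le
  rw [hX.stabUnif_eq_comap_X, hX.stabUnif_eq_comap_BM]
  intro W hW
  rw [mem_uniformity_comap_iff] at hW ⊢
  obtain ⟨F, τ, hW⟩ := hW
  obtain ⟨x₀⟩ := ‹Nonempty X›
  let π : BM X → X := fun p => match p with
    | pt x _ => x
    | gap _ => x₀
  refine ⟨F.image π, τ, fun g h hgh => hW g h fun p hp t ht => ?_⟩
  cases p with
  | pt x j =>
    have := hgh x (Finset.mem_image.2 ⟨_, hp, rfl⟩) t ht
    rw [smul_pt, smul_pt, cut_pt_zero, cut_pt_zero] at this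
    rw [smul_pt, smul_pt, cut_pt, cut_pt, this]
  | gap A => rw [smul_eq_of_not_isProper g (hc A), smul_eq_of_not_isProper h (hc A)]

end ChainEllis

end

open ChainEllis
theorem mainTheorem1 {X : Type*} [LinearOrder X] [Infinite X]
    [TopologicalSpace X] [DiscreteTopology X] (hX : IsUltrahomogeneous X) :
    ∃ U : UniformSpace X, IsMaximalEquiuniformity (X ≃o X) U ∧
      -- `U` is totally bounded and its completion is `b_m X`, with the natural action
      IsTBEquiuniformity (X ≃o X) U ∧
      IsMinimalLOCompactification (BM X) (fun x : X => BM.pt x 0) ∧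
      (∃ Φ : UCompl U ≃ₜ BM X, (∀ x : X, Φ (UCompl.coe U x) = BM.pt x 0) ∧
        ∀ (g : X ≃o X) (p : UCompl U), Φ (UCompl.map U (fun x => g • x) p) = g • Φ p) ∧
      -- `𝔈_α(U) = L ∧ R = R_{Σ_X} ⊆ R_{Σ_{b_m X}}`, and `G` is Roelcke precompact
      ellisUnif (X ≃o X) U = roelcke (X ≃o X) ∧
      roelcke (X ≃o X) = stabUnif (X ≃o X) X ∧
      stabUnif (X ≃o X) (BM X) ≤ stabUnif (X ≃o X) X ∧
      IsTBEquiuniformity (X ≃o X) (roelcke (X ≃o X)) ∧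
      -- `L ∧ R ⊆ 𝔈~_α(U) = R_{Σ_{b_m X}} = 𝔈~_*(L ∧ R)`
      ellisUnifExt (X ≃o X) U ≤ roelcke (X ≃o X) ∧
      ellisUnifExt (X ≃o X) U = stabUnif (X ≃o X) (BM X) ∧
      ellisUnifExt (X ≃o X) (roelcke (X ≃o X)) = ellisUnifExt (X ≃o X) U ∧
      IsEllisEquiuniformity (X ≃o X) (ellisUnifExt (X ≃o X) U) ∧
      (stabUnif (X ≃o X) X ≠ stabUnif (X ≃o X) (BM X) →
        ¬ IsEllisEquiuniformity (X ≃o X) (roelcke (X ≃o X))) ∧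
      -- the proper Ellis semigroup compactification `bG`, with composition of maps
      (∃ (m : Semigroup (EllisMaps X)) (s : (X ≃o X) → EllisMaps X),
        (∀ f h : EllisMaps X, (m.mul f h).1 = f.1 ∘ h.1) ∧
        (∀ (g : X ≃o X) (p : BM X), (s g).1 p = g • p) ∧
        IsEllisCompactification (X ≃o X) (EllisMaps X) s ∧
        ∃ Φ : UCompl (stabUnif (X ≃o X) (BM X)) ≃ₜ EllisMaps X,
          ∀ g : X ≃o X, Φ (UCompl.coe (stabUnif (X ≃o X) (BM X)) g) = s g) ∧
      -- the Roelcke compactification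
      (∃ Ψ : UCompl (roelcke (X ≃o X)) ≃ₜ RoelckeMaps X,
        ∀ (g : X ≃o X) (x : X), (Ψ (UCompl.coe (roelcke (X ≃o X)) g)).1 x = BM.pt (g x) 0) ∧
      (IsContinuousChain X →
        -- all the uniformities coincide
        ellisUnifExt (X ≃o X) U = ellisUnif (X ≃o X) U ∧
        ellisUnif (X ≃o X) U = roelcke (X ≃o X) ∧
        roelcke (X ≃o X) = stabUnif (X ≃o X) X ∧
        stabUnif (X ≃o X) X = stabUnif (X ≃o X) (BM X) ∧
        -- and the Roelcke compactification is a proper Ellis semigroup compactification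
        IsEllisEquiuniformity (X ≃o X) (roelcke (X ≃o X)) ∧
        ∃ Θ : UCompl (roelcke (X ≃o X)) ≃ₜ UCompl (stabUnif (X ≃o X) (BM X)),
          ∀ g : X ≃o X, Θ (UCompl.coe (roelcke (X ≃o X)) g) =
            UCompl.coe (stabUnif (X ≃o X) (BM X)) g) := by
  have := hX.denselyOrdered
  have := hX.noMinOrder
  have := hX.noMaxOrder
  have hsat := isTBEquiuniformity_chainUnif (X := X)
  obtain ⟨Φ, hΦ⟩ := exists_uniformEquiv_chainUnif (X := X)
  have hE : ellisUnif (X ≃o X) (chainUnif X) = stabUnif (X ≃o X) X := by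
    rw [ellisUnif_chainUnif, hX.stabUnif_eq_comap_X]
  have hT : ellisUnifExt (X ≃o X) (chainUnif X) = stabUnif (X ≃o X) (BM X) := by
    rw [ellisUnifExt_eq_comap Φ hΦ hsat.1.saturated fun _ _ => rfl, hX.stabUnif_eq_comap_BM]
  have hR : ellisUnifExt (X ≃o X) (roelcke (X ≃o X)) = stabUnif (X ≃o X) (BM X) := by
    rw [hX.ellisUnifExt_roelcke, hX.stabUnif_eq_comap_BM]
  have hRS : roelcke (X ≃o X) = stabUnif (X ≃o X) X := roelcke_eq_stabUnif
  have hEllis := hX.isEllisEquiuniformity_stabUnif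
  refine ⟨chainUnif X, hX.isMaximalEquiuniformity, hsat, BM.isMinimalLOCompactification,
    ⟨Φ.toHomeomorph, hΦ, fun g => UCompl.apply_map Φ.continuous hΦ (hsat.1.saturated g)
      (continuous_const_smul g) fun _ => rfl⟩,
    hE.trans hRS.symm, hRS, stabUnif_BM_le, hX.isTBEquiuniformity_roelcke,
    by rw [hT, hRS]; exact stabUnif_BM_le, hT, hR.trans hT.symm, hT ▸ hEllis, ?_, ?_, ?_, ?_⟩
  · refine fun hne h => hne (le_antisymm ?_ stabUnif_BM_le)
    rw [← hRS, ← hR]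
    exact h.le_ellisUnifExt
  · obtain ⟨Θ, hΘ⟩ := hX.exists_uniformEquiv_stabUnif
    exact ⟨inferInstance, EllisMaps.ofAut, fun _ _ => rfl, fun _ _ => rfl,
      hX.isEllisCompactification, Θ.toHomeomorph, hΘ⟩
  · obtain ⟨Ψ, hΨ⟩ := hX.exists_uniformEquiv_roelcke
    refine ⟨Ψ.toHomeomorph, fun g x => ?_⟩
    exact congrFun (congrArg Subtype.val (hΨ g)) x
  · intro hc
    have hXB := hX.stabUnif_eq_of_isContinuousChain hc
    refine ⟨by rw [hT, hE, hXB], hE.trans hRS.symm, hRS, hXB, ?_,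
      UCompl.exists_homeomorph_of_eq (hRS.trans hXB)⟩
    rw [hRS, hXB]
    exact hEllis
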